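/- All graphs are finite and simple, and $e(F)$ denotes the number of edges of $F$. A subdivision of a graph $F$ is a graph obtained from $F$ by replacing its edges with internally vertex-disjoint paths between their endpoints. Two subgraphs of a graph $G$ are distinguishable if their vertex sets are different; $s(F,G)$ denotes the largest size of a family of pairwise distinguishable subgraphs of $G$ each of which is a subdivision of $F$. For an integer $t\ge 0$, $G$ is $(F,t)$-locally dense if every edge of $G$ lies in at least $t$ copies of $F$ in $G$ (subgraphs of $G$ isomorphic to $F$), and $s_t(F)$ denotes the minimum of $s(F,G)$ over all $(F,t)$-locally dense graphs $G$ with at least one edge. Theorem. Let $\ell\ge 3$ be an integer. There are a constant $c'=c'(\ell)\ge \frac{1}{2(\ell-2)}$ and a function $o(1)$ of $t$, depending only on $\ell$ and tending to $0$ as $t\to\infty$, such that for all sufficiently large integers $t$ (in terms of $\ell$) the following hold. (i) $s_t(K_\ell)\ge 2^{t^{c'}}$. (ii) For every graph $F$ on $\ell$ vertices that has at least one edge and is not complete, $$s_t(F)\le 2^{\ell}(t+2)^{e(F)+2\ell}.$$ Moreover, there is an $(F,t)$-locally dense graph $G$ with $s(F,G)\le 2^{\ell}(t+2)^{e(F)+2\ell}$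 whose vertex set is a disjoint union $A\cup B$ with $|A|=\ell-2$ and $|B|=t+1$, where $B$ is independent and every vertex of $A$ is adjacent to every vertex of $B$. (iii) If $\ell\ge 4$, then $$s_t(K_\ell^-)\ge t^{(1-o(1))(e(K_\ell^-)-2\ell+5)},$$ where $K_\ell^-$ is the graph obtained from $K_\ell$ by removing one edge. -/

import Mathlib

namespace LocalSubdivisions

/-- A witness that the graph `T` is a subdivision of the graph `F`: `T` is obtained from `F` by
replacing the edges of `F` by internally vertex-disjoint paths between their endpoints. The path of
an edge is given for both of its orientations, one being the reverse of the other. -/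
structure Subdivision {U W : Type*} (F : SimpleGraph U) (T : SimpleGraph W) where
  /-- the branch vertices -/
  branch : U ↪ W
  /-- the paths replacing the edges -/
  path : ∀ {u v : U}, F.Adj u v → T.Path (branch u) (branch v)
  path_symm : ∀ {u v : U} (h : F.Adj u v), path h.symm = (path h).reverse
  /-- no path has a branch vertex in its interior -/
  eq_or_eq_of_branch_mem : ∀ {u v : U} (h : F.Adj u v) (x : U),
    branch x ∈ (path h : T.Walk (branch u) (branch v)).support → x = u ∨ x = v
  /-- the paths of two different edges share no vertices other than branch vertices -/
  disjoint : ∀ {u v u' v' : U} (h : F.Adj u v) (h' : F.Adj u' v'), s(u, v) ≠ s(u', v') →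
    ∀ w : W, w ∈ (path h : T.Walk (branch u) (branch v)).support →
      w ∈ (path h' : T.Walk (branch u') (branch v')).support → w ∈ Set.range branch
  /-- `T` has no further vertices -/
  vertex_mem : ∀ w : W, w ∈ Set.range branch ∨
    ∃ (u v : U) (h : F.Adj u v), w ∈ (path h : T.Walk (branch u) (branch v)).support
  /-- `T` has no further edges -/
  edge_mem : ∀ e ∈ T.edgeSet,
    ∃ (u v : U) (h : F.Adj u v), e ∈ (path h : T.Walk (branch u) (branch v)).edges

/-- The graph `T` is a subdivision of the graph `F`. -/
def IsSubdivision {U W : Type*} (F : SimpleGraph U) (T : SimpleGraph W) : Prop :=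
  Nonempty (Subdivision F T)

/-- Two subgraphs of `G` are distinguishable if their vertex sets differ. -/
def Distinguishable {V : Type*} {G : SimpleGraph V} (H H' : G.Subgraph) : Prop :=
  H.verts ≠ H'.verts

/-- `s(F, G)`: the size of a largest collection of pairwise distinguishable subgraphs of `G` that
are subdivisions of `F`. (Used for finite `G`.) -/
noncomputable def maxSubdivisions {U V : Type*} (F : SimpleGraph U) (G : SimpleGraph V) : ℕ :=
  sSup {n : ℕ | ∃ C : Finset G.Subgraph, (∀ H ∈ C, IsSubdivision F H.coe) ∧
    (C : Set G.Subgraph).Pairwise Distinguishable ∧ C.card = n}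

/-- `G` is `(F, t)`-locally dense: every edge of `G` lies in at least `t` copies of `F`, a copy
being a subgraph of `G` that is isomorphic to `F`. (Used for finite `G`.) -/
def LocallyDense {U V : Type*} (F : SimpleGraph U) (t : ℕ) (G : SimpleGraph V) : Prop :=
  ∀ e ∈ G.edgeSet, t ≤ {H : G.Subgraph | e ∈ H.edgeSet ∧ Nonempty (F ≃g H.coe)}.ncard

/-- `s_t(F)`: the minimum of `s(F, G)` over all finite `(F, t)`-locally dense graphs `G` with at
least one edge. -/
noncomputable def minSubdivisions {U : Type*} (F : SimpleGraph U) (t : ℕ) : ℕ :=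
  sInf {n : ℕ | ∃ (V : Type) (_ : Finite V) (G : SimpleGraph V),
    G ≠ ⊥ ∧ LocallyDense F t G ∧ maxSubdivisions F G = n}

/-- The graph on `A ∪ B` that induces `H` on `A`, in which `B` is independent, and in which every
vertex of `A` is adjacent to every vertex of `B`. -/
def joinIndependent {A : Type*} (H : SimpleGraph A) (B : Type*) : SimpleGraph (A ⊕ B) :=
  (H ⊕g (⊥ : SimpleGraph B)) ⊔ completeBipartiteGraph A B

end LocalSubdivisions

/-!
All three parts rest on counting vertex sets of subdivisions directly.

*Many triangles on every edge.* If every edge of `G` lies in at least `D` triangles, then an edge of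
a copy of `F` in `G` can be replaced by long paths: grow the path along triangles, and at each of
about `D / 2` steps choose freely whether to include one more fresh vertex. This gives about
`2 ^ (D / 2)` distinguishable subdivisions (`two_pow_le_maxSubdivisions`). If an edge lies in `t`
copies of `K_ℓ`, its ends have at least `(t / ℓ²)^(1 / (ℓ - 2))` common neighbours
(`le_ncard_commonNeighbors_pow`). Here `D` is so much larger than `t^(1 / (2(ℓ - 2)))` that the bound
for `K_ℓ` holds with `c' = 1 / (2(ℓ - 2))`.

*The complete graph minus an edge.* Let `M = C(ℓ - 2, 2) + 1`, which is the exponent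
`e(K_ℓ⁻) - 2ℓ + 5`. If every edge has more than `C log t` common neighbours, the previous bound
exceeds `t ^ M`. Otherwise consider an edge `ab` with few common neighbours. All vertices of a copy of
`K_ℓ⁻` through `ab`, except for `a`, `b` and one of the two non-adjacent vertices, are common
neighbours of `a` and `b`, so by pigeonhole some `ℓ - 2` vertices have `n ≥ t / polylog t` common
neighbours (`exists_many_commonNeighbors`). Every set of `M + 1` of these is used up by a
subdivision: two of them are branch vertices and each of the others joins its own pair of the
`ℓ - 2` vertices (`choose_le_maxSubdivisions`). As `C(n, M + 1)` is at least `t ^ (M + 1)` up to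
polylogarithmic factors, it exceeds `t ^ M` for large `t`. So the `o(1)` term can be taken to be `0`.

*Other graphs.* In the join of a graph on `A` with an independent set `B`, each vertex of `B` interior
to a path of a subdivision is followed on the path by a vertex of `A`. Hence a subdivision of `F` uses
at most `|F| + |A| + e(F)` vertices of `B`, and there are only polynomially many vertex sets
(`maxSubdivisions_joinIndependent_le`). The join is locally dense for a complete or an empty graph on
`A`: place two non-adjacent vertices of `F` in `B`, one of which can be moved freely
(`exists_locallyDense_joinIndependent`).
-/

namespace LocalSubdivisions

variable {U V : Type*}

/-! ### Building subdivisions -/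

/-- A walk of `G` all of whose edges belong to the subgraph `H` lifts to `H.coe`. -/
lemma exists_lift_walk {G : SimpleGraph V} (H : G.Subgraph) {a b : V} (p : G.Walk a b)
    (ha : a ∈ H.verts) (hb : b ∈ H.verts) (hp : ∀ e ∈ p.edges, e ∈ H.edgeSet) :
    ∃ q : H.coe.Walk ⟨a, ha⟩ ⟨b, hb⟩, q.map H.hom = p := by
  induction p with
  | nil => exact ⟨.nil, rfl⟩
  | @cons x y z h p ih =>
    have hxy : H.Adj x y := by
      have := hp s(x, y) (by simp)
      simpa using this
    obtain ⟨q, hq⟩ := ih hxy.snd_mem hb (fun e he => hp e (by simp [he]))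
    have hxy' : H.coe.Adj ⟨x, ha⟩ ⟨y, hxy.snd_mem⟩ := hxy
    refine ⟨.cons hxy' q, ?_⟩
    rw [SimpleGraph.Walk.map_cons, hq]
    rfl

/-- Branch vertices `br` and pairwise disjoint sets `I e` of interior vertices, such that for every
edge `uv` of `F` there is a path of `G` on `{br u, br v} ∪ I s(u, v)`, yield a subdivision of `F`
in `G` whose vertex set consists of the branch vertices and the sets `I e`. It suffices to give the
paths for one orientation of each edge. -/
lemma exists_subdivision [LinearOrder U] {F : SimpleGraph U} {G : SimpleGraph V} {br : U → V}
    (hbri : Function.Injective br)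
    (I : Sym2 U → Set V) (hIbr : ∀ e ∈ F.edgeSet, ∀ u, br u ∉ I e)
    (hI : ∀ e ∈ F.edgeSet, ∀ e' ∈ F.edgeSet, e ≠ e' → Disjoint (I e) (I e'))
    (hp : ∀ u v, u < v → F.Adj u v → ∃ p : G.Walk (br u) (br v), p.IsPath ∧
      ∀ w, w ∈ p.support ↔ w = br u ∨ w = br v ∨ w ∈ I s(u, v)) :
    ∃ H : G.Subgraph, IsSubdivision F H.coe ∧
      H.verts = Set.range br ∪ ⋃ e ∈ F.edgeSet, I e := by
  -- paths of `G` for both orientations, the second one obtained by reversal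
  have key : ∃ P : ∀ u v, F.Adj u v → G.Walk (br u) (br v),
      (∀ u v h, (P u v h).IsPath) ∧
      (∀ u v h w, w ∈ (P u v h).support ↔ w = br u ∨ w = br v ∨ w ∈ I s(u, v)) ∧
      ∀ u v (h : F.Adj u v), P v u h.symm = (P u v h).reverse := by
    choose P hP hS using hp
    refine ⟨fun u v h => if huv : u < v then P u v huv h else
      (P v u (lt_of_le_of_ne (not_lt.1 huv) h.ne.symm) h.symm).reverse, ?_, ?_, ?_⟩
    · intro u v h
      dsimp only
      split_ifs with huv
      · exact hP _ _ _ _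
      · exact (hP _ _ _ _).reverse
    · intro u v h w
      dsimp only
      split_ifs with huv
      · exact hS _ _ _ _ _
      · rw [SimpleGraph.Walk.support_reverse, List.mem_reverse, hS, Sym2.eq_swap]
        tauto
    · intro u v h
      dsimp only
      rcases lt_or_gt_of_ne h.ne with huv | huv
      · simp [huv, huv.not_gt]
      · simp [huv, huv.not_gt]
  obtain ⟨P, hP, hS, hR⟩ := key
  let H : G.Subgraph :=
    { verts := Set.range br ∪ ⋃ e ∈ F.edgeSet, I e
      Adj := fun a b => ∃ u v, ∃ h : F.Adj u v, s(a, b) ∈ (P u v h).edges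
      adj_sub := by
        rintro a b ⟨u, v, h, hab⟩
        exact (P u v h).adj_of_mem_edges hab
      edge_vert := by
        rintro a b ⟨u, v, h, hab⟩
        rcases (hS u v h a).1 ((P u v h).fst_mem_support_of_mem_edges hab) with rfl | rfl | h1
        · exact Or.inl ⟨_, rfl⟩
        · exact Or.inl ⟨_, rfl⟩
        · exact Or.inr (Set.mem_biUnion (show s(u, v) ∈ F.edgeSet from h) h1)
      symm := by
        constructor
        rintro a b ⟨u, v, h, hab⟩
        exact ⟨u, v, h, by rwa [Sym2.eq_swap]⟩ }
  have hbr : ∀ u, br u ∈ H.verts := fun u => Or.inl ⟨u, rfl⟩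
  have hE : ∀ u v (h : F.Adj u v), ∀ e ∈ (P u v h).edges, e ∈ H.edgeSet := by
    intro u v h e he
    induction e with
    | h a b => exact ⟨u, v, h, he⟩
  have hlift := fun u v (h : F.Adj u v) =>
    exists_lift_walk H (P u v h) (hbr u) (hbr v) (hE u v h)
  choose Q hQ using hlift
  have hinj : Function.Injective H.hom := SimpleGraph.Subgraph.hom_injective
  have hQpath : ∀ u v h, (Q u v h).IsPath := by
    intro u v h
    rw [← SimpleGraph.Walk.isPath_map_iff_of_injective hinj, hQ]
    exact hP u v h
  have hQS : ∀ u v h w, w ∈ (Q u v h).support ↔ w.1 ∈ (P u v h).support := by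
    intro u v h w
    have h1 : (P u v h).support = (Q u v h).support.map H.hom := by
      rw [← SimpleGraph.Walk.support_map]
      exact congrArg SimpleGraph.Walk.support (hQ u v h).symm
    rw [h1]
    exact (List.mem_map_of_injective hinj).symm
  have hQE : ∀ u v h e, e ∈ (Q u v h).edges ↔ e.map H.hom ∈ (P u v h).edges := by
    intro u v h e
    have h1 : (P u v h).edges = (Q u v h).edges.map (Sym2.map H.hom) := by
      rw [← SimpleGraph.Walk.edges_map]
      exact congrArg SimpleGraph.Walk.edges (hQ u v h).symm
    rw [h1]
    exact (List.mem_map_of_injective (Sym2.map.injective hinj)).symm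
  refine ⟨H, ⟨?_⟩, rfl⟩
  refine
    { branch := ⟨fun u => ⟨br u, hbr u⟩, fun u v huv => hbri (congrArg Subtype.val huv)⟩
      path := fun {u v} h => ⟨Q u v h, hQpath u v h⟩
      path_symm := ?_
      eq_or_eq_of_branch_mem := ?_
      disjoint := ?_
      vertex_mem := ?_
      edge_mem := ?_ }
  · intro u v h
    apply Subtype.ext
    apply SimpleGraph.Walk.map_injective_of_injective hinj
    change (Q v u h.symm).map H.hom = (Q u v h).reverse.map H.hom
    rw [← SimpleGraph.Walk.reverse_map, hQ v u h.symm, hQ u v h, hR u v h]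
    rfl
  · intro u v h x hx
    have := (hS u v h (br x)).1 ((hQS u v h _).1 hx)
    rcases this with h1 | h1 | h1
    · exact Or.inl (hbri h1)
    · exact Or.inr (hbri h1)
    · exact absurd h1 (hIbr s(u, v) h x)
  · intro u v u' v' h h' hne w hw hw'
    have key : ∀ u v (h : F.Adj u v), w ∈ (Q u v h).support →
        (∃ x, br x = w.1) ∨ w.1 ∈ I s(u, v) := by
      intro u v h hw
      rcases (hS u v h w.1).1 ((hQS u v h _).1 hw) with h1 | h1 | h1
      · exact Or.inl ⟨u, h1.symm⟩
      · exact Or.inl ⟨v, h1.symm⟩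
      · exact Or.inr h1
    have fin : (∃ x, br x = w.1) → w ∈ Set.range (fun u => (⟨br u, hbr u⟩ : H.verts)) := by
      rintro ⟨x, hx⟩
      exact ⟨x, Subtype.ext hx⟩
    rcases key u v h hw with h1 | h1
    · exact fin h1
    rcases key u' v' h' hw' with h2 | h2
    · exact fin h2
    exact absurd h2 (Set.disjoint_left.1 (hI _ h _ h' hne) h1)
  · rintro ⟨w, ⟨x, rfl⟩ | hw⟩
    · exact Or.inl ⟨x, rfl⟩
    · obtain ⟨e, he, hwe⟩ := Set.mem_iUnion₂.1 hw
      induction e with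
      | h u v =>
        exact Or.inr ⟨u, v, he, (hQS u v he _).2 ((hS u v he w).2 (Or.inr (Or.inr hwe)))⟩
  · intro e he
    induction e with
    | h a b =>
      obtain ⟨u, v, h, hab⟩ := he
      exact ⟨u, v, h, (hQE u v h _).2 hab⟩

/-! ### The number of distinguishable subdivisions -/

lemma bddAbove_distinguishable [Finite V] (F : SimpleGraph U) (G : SimpleGraph V) :
    BddAbove {n : ℕ | ∃ C : Finset G.Subgraph, (∀ H ∈ C, IsSubdivision F H.coe) ∧
      (C : Set G.Subgraph).Pairwise Distinguishable ∧ C.card = n} := by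
  have := Fintype.ofFinite G.Subgraph
  refine ⟨Fintype.card G.Subgraph, ?_⟩
  rintro n ⟨C, -, -, rfl⟩
  exact Finset.card_le_univ C

lemma card_le_maxSubdivisions [Finite V] {F : SimpleGraph U} {G : SimpleGraph V}
    (S : Finset (Set V)) (hS : ∀ s ∈ S, ∃ H : G.Subgraph, IsSubdivision F H.coe ∧ H.verts = s) :
    S.card ≤ maxSubdivisions F G := by
  classical
  choose! f hf hv using hS
  have hinj : Set.InjOn f S := fun s hs s' hs' h => by
    rw [← hv s hs, ← hv s' hs', h]
  refine le_csSup (bddAbove_distinguishable F G) ⟨S.image f, ?_, ?_, ?_⟩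
  · intro H hH
    obtain ⟨s, hs, rfl⟩ := Finset.mem_image.1 hH
    exact hf s hs
  · intro H hH H' hH' hne
    obtain ⟨s, hs, rfl⟩ := Finset.mem_image.1 hH
    obtain ⟨s', hs', rfl⟩ := Finset.mem_image.1 hH'
    intro h
    rw [hv s hs, hv s' hs'] at h
    exact hne (h ▸ rfl)
  · exact Finset.card_image_of_injOn hinj

lemma maxSubdivisions_le {F : SimpleGraph U} {G : SimpleGraph V}
    (S : Finset (Set V)) (hS : ∀ H : G.Subgraph, IsSubdivision F H.coe → H.verts ∈ S) :
    maxSubdivisions F G ≤ S.card := by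
  classical
  refine csSup_le ⟨0, ∅, by simp⟩ ?_
  rintro n ⟨C, hC, hd, rfl⟩
  refine Finset.card_le_card_of_injOn (fun H => H.verts) (fun H hH => hS H (hC H hH)) ?_
  intro H hH H' hH' h
  by_contra hne
  exact hd hH hH' hne h

/-! ### Graphs of large codegree -/

/-- If every edge lies in at least `D` triangles then there are `2 ^ n` vertex sets of paths between
two given adjacent vertices that avoid a given small set `X`. Such a path is built along a fan at
`v`: from the current vertex `u` one moves to a common neighbour `w` of `u` and `v`, either directly
or through a common neighbour `x` of `u` and `w`; each such choice doubles the number of sets. -/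
lemma exists_path_vertex_sets [DecidableEq V] [Finite V] {G : SimpleGraph V} {D : ℕ}
    (hD : ∀ u v, G.Adj u v → D ≤ (G.commonNeighbors u v).ncard) (n : ℕ) :
    ∀ (X : Finset V) (u v : V), G.Adj u v → u ∉ X → v ∉ X → X.card + 2 * n ≤ D →
      ∃ S : Finset (Finset V), S.card = 2 ^ n ∧ ∀ s ∈ S, Disjoint s X ∧ u ∉ s ∧ v ∉ s ∧
        ∃ p : G.Walk u v, p.IsPath ∧ ∀ w, w ∈ p.support ↔ w = u ∨ w = v ∨ w ∈ s := by
  induction n with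
  | zero =>
    intro X u v huv hu hv _
    refine ⟨{∅}, by simp, ?_⟩
    simp only [Finset.mem_singleton, forall_eq, Finset.disjoint_empty_left, Finset.notMem_empty,
      not_false_eq_true, true_and]
    exact ⟨.cons huv .nil, by simp [huv.ne], by simp⟩
  | succ n ih =>
    intro X u v huv hu hv hX
    -- a common neighbour outside a set of fewer than `D` vertices
    have fresh : ∀ (Y : Finset V) (a b : V), G.Adj a b → Y.card < D →
        ∃ w, G.Adj a w ∧ G.Adj b w ∧ w ∉ Y := by
      intro Y a b hab hY
      by_contra! hcon
      have hsub : G.commonNeighbors a b ⊆ (Y : Set V) := fun w hw => hcon w hw.1 hw.2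
      have h1 := Set.ncard_le_ncard hsub Y.finite_toSet
      rw [Set.ncard_coe_finset] at h1
      have := hD a b hab
      omega
    obtain ⟨w, huw, hvw, hwX⟩ := fresh X u v huv (by omega)
    obtain ⟨x, hux, hwx, hxX⟩ := fresh (insert v X) u w huw
      (by have := Finset.card_insert_le v X; omega)
    rw [Finset.mem_insert, not_or] at hxX
    obtain ⟨S, hSc, hS⟩ := ih (insert u (insert x X)) w v hvw.symm
      (by simp [huw.ne', hwx.ne, hwX]) (by simp [huv.ne', Ne.symm hxX.1, hv])
      (by
        have h1 := Finset.card_insert_le x X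
        have h2 := Finset.card_insert_le u (insert x X)
        omega)
    have hS' : ∀ s ∈ S, Disjoint s X ∧ u ∉ s ∧ x ∉ s ∧ w ∉ s ∧ v ∉ s := by
      intro s hs
      obtain ⟨h1, h2, h3, -⟩ := hS s hs
      simp only [Finset.disjoint_insert_right] at h1
      exact ⟨h1.2.2, h1.1, h1.2.1, h2, h3⟩
    refine ⟨S.image (insert w) ∪ S.image (fun s => insert x (insert w s)), ?_, ?_⟩
    · rw [Finset.card_union_of_disjoint, Finset.card_image_of_injOn, Finset.card_image_of_injOn,
        hSc, pow_succ, mul_two]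
      · intro s hs s' hs' h
        have h1 := hS' s hs
        have h2 := hS' s' hs'
        have e1 : ∀ r : Finset V, x ∉ r → w ∉ r →
            ((insert x (insert w r)).erase x).erase w = r := by
          intro r hx hw
          rw [Finset.erase_insert (by simp [hx, hwx.ne']), Finset.erase_insert hw]
        rw [← e1 s h1.2.2.1 h1.2.2.2.1, ← e1 s' h2.2.2.1 h2.2.2.2.1]
        exact congrArg (fun r => (r.erase x).erase w) h
      · intro s hs s' hs' h
        rw [← Finset.erase_insert (hS' s hs).2.2.2.1, ← Finset.erase_insert (hS' s' hs').2.2.2.1]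
        exact congrArg (fun r => r.erase w) h
      · rw [Finset.disjoint_left]
        intro r hr hr'
        obtain ⟨s, hs, rfl⟩ := Finset.mem_image.1 hr
        obtain ⟨s', hs', h⟩ := Finset.mem_image.1 hr'
        have hx : x ∈ insert w s := h ▸ Finset.mem_insert_self x _
        rcases Finset.mem_insert.1 hx with h1 | h1
        · exact hwx.ne h1.symm
        · exact (hS' s hs).2.2.1 h1
    · intro r hr
      rcases Finset.mem_union.1 hr with hr | hr
      · obtain ⟨s, hs, rfl⟩ := Finset.mem_image.1 hr
        obtain ⟨hsX, hus, hxs, hws, hvs⟩ := hS' s hs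
        obtain ⟨-, -, -, p, hp, hps⟩ := hS s hs
        refine ⟨by simp [hwX, hsX], by simp [huw.ne, hus], by simp [hvw.ne, hvs],
          .cons huw p, ?_, ?_⟩
        · rw [SimpleGraph.Walk.cons_isPath_iff]
          refine ⟨hp, ?_⟩
          rw [hps]
          simp [huw.ne, huv.ne, hus]
        · intro z
          simp only [SimpleGraph.Walk.support_cons, List.mem_cons, hps, Finset.mem_insert]
          tauto
      · obtain ⟨s, hs, rfl⟩ := Finset.mem_image.1 hr
        obtain ⟨hsX, hus, hxs, hws, hvs⟩ := hS' s hs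
        obtain ⟨-, -, -, p, hp, hps⟩ := hS s hs
        refine ⟨by simp [hwX, hsX, hxX.2], by simp [huw.ne, hus, hux.ne],
          by simp [hvw.ne, hvs, Ne.symm hxX.1], .cons hux (.cons hwx.symm p), ?_, ?_⟩
        · rw [SimpleGraph.Walk.cons_isPath_iff, SimpleGraph.Walk.cons_isPath_iff, hps]
          refine ⟨⟨hp, ?_⟩, ?_⟩
          · simp [hwx.ne', hxX.1, hxs]
          · simp [hux.ne, hps, huw.ne, huv.ne, hus]
        · intro z
          simp only [SimpleGraph.Walk.support_cons, List.mem_cons, hps, Finset.mem_insert]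
          tauto

/-- If every edge of `G` lies in many triangles and `G` contains `F`, then replacing one edge of a
copy of `F` by long paths gives exponentially many distinguishable subdivisions. -/
lemma two_pow_le_maxSubdivisions [LinearOrder U] [Fintype U] [Finite V] {F : SimpleGraph U}
    {G : SimpleGraph V} (f : F.Copy G) {a b : U} (hab : F.Adj a b) {D n : ℕ}
    (hD : ∀ u v, G.Adj u v → D ≤ (G.commonNeighbors u v).ncard)
    (hn : Fintype.card U + 2 * n ≤ D) : 2 ^ n ≤ maxSubdivisions F G := by
  classical
  wlog hlt : a < b generalizing a b
  · exact this hab.symm (lt_of_le_of_ne (not_lt.1 hlt) hab.ne')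
  set X : Finset V := (Finset.univ.filter fun u => u ≠ a ∧ u ≠ b).image f with hX
  have hXc : X.card ≤ Fintype.card U :=
    Finset.card_image_le.trans (Finset.card_le_univ _)
  have hfi : Function.Injective f := f.injective
  obtain ⟨S, hSc, hS⟩ := exists_path_vertex_sets hD n X (f a) (f b) (f.toHom.map_adj hab)
    (by simp [hX, hfi.eq_iff]) (by simp [hX, hfi.eq_iff]) (by omega)
  have hout : ∀ s ∈ S, ∀ u, f u ∉ s := by
    intro s hs u hu
    obtain ⟨h1, h2, h3, -⟩ := hS s hs
    by_cases ha : u = a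
    · exact h2 (ha ▸ hu)
    by_cases hb : u = b
    · exact h3 (hb ▸ hu)
    exact Finset.disjoint_left.1 h1 hu
      (Finset.mem_image_of_mem f (by simp [ha, hb]))
  have hinj : Set.InjOn (fun s : Finset V => Set.range f ∪ (s : Set V)) (S : Set (Finset V)) := by
    intro s hs s' hs' h
    have key : ∀ s ∈ S, (s : Set V) = (Set.range f ∪ (s : Set V)) \ Set.range f := by
      intro s hs
      rw [Set.union_sdiff_left, eq_comm, sdiff_eq_left, Set.disjoint_left]
      rintro z hz ⟨u, rfl⟩
      exact hout s hs u hz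
    have h' : (Set.range f ∪ (s : Set V)) = Set.range f ∪ (s' : Set V) := h
    apply Finset.coe_injective
    rw [key s hs, key s' hs', h']
  rw [← hSc, ← Finset.card_image_of_injOn hinj]
  refine card_le_maxSubdivisions _ ?_
  intro r hr
  obtain ⟨s, hs, rfl⟩ := Finset.mem_image.1 hr
  obtain ⟨-, -, -, p, hp, hps⟩ := hS s hs
  obtain ⟨H, hH, hHv⟩ := exists_subdivision (F := F) (G := G) (br := f) hfi
    (fun e => if e = s(a, b) then (s : Set V) else ∅)
    (by
      intro e _ u
      split_ifs
      · exact hout s hs u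
      · exact Set.notMem_empty _)
    (by
      intro e _ e' _ hne
      split_ifs with h1 h2
      · exact absurd (h1.trans h2.symm) hne
      all_goals simp)
    (by
      intro u v huv h
      by_cases he : s(u, v) = s(a, b)
      · have : u = a ∧ v = b := by
          rcases Sym2.eq_iff.1 he with h1 | ⟨rfl, rfl⟩
          · exact h1
          · exact absurd huv hlt.not_gt
        obtain ⟨rfl, rfl⟩ := this
        exact ⟨p, hp, by simpa using hps⟩
      · have hadj : G.Adj (f u) (f v) := f.toHom.map_adj h
        refine ⟨.cons hadj .nil, ?_, ?_⟩
        · rw [SimpleGraph.Walk.cons_isPath_iff]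
          simpa using hadj.ne
        · intro w
          rw [if_neg he]
          simp)
  refine ⟨H, hH, ?_⟩
  rw [hHv]
  congr 1
  ext z
  simp only [Set.mem_iUnion, exists_prop]
  constructor
  · rintro ⟨e, -, hz⟩
    split_ifs at hz
    · exact hz
    · exact absurd hz (Set.notMem_empty _)
  · intro hz
    exact ⟨s(a, b), hab, by simpa using hz⟩

/-! ### Counting copies through an edge -/

/-- A family of injective homomorphisms with distinct images, all of which use the edge `ab`, gives
as many copies of `F` through `ab`. -/
lemma card_le_ncard_copies [Finite V] {F : SimpleGraph U} {G : SimpleGraph V} {a b : V}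
    {ι : Type*} (S : Finset ι) (f : ι → F.Copy G)
    (hS : ∀ i ∈ S, ∀ j ∈ S, Set.range (f i) = Set.range (f j) → i = j)
    (hab : ∀ i ∈ S, ∃ u v, F.Adj u v ∧ f i u = a ∧ f i v = b) :
    S.card ≤ {H : G.Subgraph | s(a, b) ∈ H.edgeSet ∧ Nonempty (F ≃g H.coe)}.ncard := by
  rw [← Set.ncard_coe_finset]
  refine Set.ncard_le_ncard_of_injOn (fun i => (f i).toSubgraph) ?_ ?_ (Set.toFinite _)
  · intro i hi
    refine ⟨?_, ⟨(f i).isoToSubgraph⟩⟩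
    obtain ⟨u, v, huv, rfl, rfl⟩ := hab i hi
    exact ⟨u, v, huv, rfl, rfl⟩
  · intro i hi j hj hij
    refine hS i hi j hj ?_
    have h := congrArg SimpleGraph.Subgraph.verts hij
    rw [SimpleGraph.Subgraph.map_verts, SimpleGraph.Subgraph.map_verts,
      SimpleGraph.Subgraph.verts_top, Set.image_univ, Set.image_univ] at h
    exact h

/-- An injective homomorphism that maps an edge to `ab` can be modified at one vertex `k` off this
edge; each possible image of `k` gives another copy through `ab`. -/
lemma card_le_ncard_copies_of_update [DecidableEq U] [Finite V] {F : SimpleGraph U}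
    {G : SimpleGraph V} {a b : V} {g : U → V} (hg : Function.Injective g) (k : U) (R : Finset V)
    (hR : ∀ z ∈ R, ∀ u, u ≠ k → g u ≠ z)
    (hadj : ∀ u v, F.Adj u v → u ≠ k → v ≠ k → G.Adj (g u) (g v))
    (hadjk : ∀ z ∈ R, ∀ u, F.Adj u k → G.Adj (g u) z)
    (hab : ∃ i j, F.Adj i j ∧ i ≠ k ∧ j ≠ k ∧ g i = a ∧ g j = b) :
    R.card ≤ {H : G.Subgraph | s(a, b) ∈ H.edgeSet ∧ Nonempty (F ≃g H.coe)}.ncard := by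
  have hinj : ∀ z ∈ R, Function.Injective (Function.update g k z) := by
    intro z hz u v huv
    by_cases hu : u = k <;> by_cases hv : v = k
    · rw [hu, hv]
    · rw [hu, Function.update_self, Function.update_of_ne hv] at huv
      exact absurd huv.symm (hR z hz v hv)
    · rw [hv, Function.update_self, Function.update_of_ne hu] at huv
      exact absurd huv (hR z hz u hu)
    · rw [Function.update_of_ne hu, Function.update_of_ne hv] at huv
      exact hg huv
  let f : R → F.Copy G := fun z =>
    { toHom := ⟨Function.update g k z, by
        intro u v huv
        by_cases hu : u = k
        · have hv : v ≠ k := fun h => huv.ne (hu.trans h.symm)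
          rw [hu, Function.update_self, Function.update_of_ne hv]
          exact (hadjk z z.2 v (hu ▸ huv.symm)).symm
        by_cases hv : v = k
        · rw [hv, Function.update_self, Function.update_of_ne hu]
          exact hadjk z z.2 u (hv ▸ huv)
        rw [Function.update_of_ne hu, Function.update_of_ne hv]
        exact hadj u v huv hu hv⟩
      injective' := hinj z z.2 }
  have hf : ∀ z u, f z u = Function.update g k z u := fun _ _ => rfl
  rw [← Finset.card_attach]
  refine card_le_ncard_copies R.attach f ?_ ?_
  · intro z _ z' _ h
    have h1 : (z : V) ∈ Set.range (f z') := by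
      rw [← h]
      exact ⟨k, by rw [hf, Function.update_self]⟩
    obtain ⟨u, hu⟩ := h1
    rw [hf] at hu
    by_cases huk : u = k
    · rw [huk, Function.update_self] at hu
      exact Subtype.ext hu.symm
    · rw [Function.update_of_ne huk] at hu
      exact absurd hu (hR z z.2 u huk)
  · obtain ⟨i, j, hij, hi, hj, rfl, rfl⟩ := hab
    intro z _
    exact ⟨i, j, hij, by rw [hf, Function.update_of_ne hi], by rw [hf, Function.update_of_ne hj]⟩

/-- If `ab` lies in `t` copies of `F`, then some edge `ij` of `F` is mapped to `ab` by at least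
`t / |U|²` of the injective homomorphisms from `F` to `G`. -/
lemma exists_many_copies [Fintype U] [Finite V] {F : SimpleGraph U} {G : SimpleGraph V}
    {a b : V} {t : ℕ} (ht : 0 < t)
    (h : t ≤ {H : G.Subgraph | s(a, b) ∈ H.edgeSet ∧ Nonempty (F ≃g H.coe)}.ncard) :
    ∃ i j, F.Adj i j ∧
      t ≤ Fintype.card U ^ 2 * {f : U → V | Function.Injective f ∧
        (∀ u v, F.Adj u v → G.Adj (f u) (f v)) ∧ f i = a ∧ f j = b}.ncard := by
  classical
  have := Fintype.ofFinite V
  have := Fintype.ofFinite (U → V)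
  let W : U × U → Finset (U → V) := fun p => Finset.univ.filter fun f => Function.Injective f ∧
        (∀ u v, F.Adj u v → G.Adj (f u) (f v)) ∧ f p.1 = a ∧ f p.2 = b
  let E : Finset (U × U) := Finset.univ.filter fun p => F.Adj p.1 p.2
  have h1 : t ≤ (E.biUnion W).card := by
    refine h.trans ?_
    rw [← Set.ncard_coe_finset]
    -- an isomorphism onto a copy, regarded as a function to `V`, determines the copy
    have hc : ∀ H : {H : G.Subgraph | s(a, b) ∈ H.edgeSet ∧ Nonempty (F ≃g H.coe)},
        ∃ f : F.Copy G, f.toSubgraph = H.1 := by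
      rintro ⟨H, -, hH⟩
      have : H ∈ Set.range (SimpleGraph.Copy.toSubgraph (A := F) (B := G)) := by
        rw [SimpleGraph.Copy.range_toSubgraph]
        exact hH
      exact this
    choose c hc using hc
    rw [← Nat.card_coe_set_eq, ← Nat.card_coe_set_eq]
    refine Nat.card_le_card_of_injective (fun H => ⟨c H, ?_⟩) ?_
    · have h2 := H.2.1
      rw [← hc H] at h2
      obtain ⟨u, v, huv, hu, hv⟩ := h2
      refine Finset.mem_coe.2 (Finset.mem_biUnion.2 ⟨(u, v), by simpa [E] using huv, ?_⟩)
      simp only [W, Finset.mem_filter, Finset.mem_univ, true_and]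
      exact ⟨(c H).injective, fun u v h => (c H).toHom.map_adj h, hu, hv⟩
    · intro H H' hHH
      have h3 : (c H : U → V) = c H' := congrArg Subtype.val hHH
      have h4 : c H = c H' := DFunLike.coe_injective h3
      exact Subtype.ext (by rw [← hc H, ← hc H', h4])
  have hne : E.Nonempty := by
    by_contra hE
    rw [Finset.not_nonempty_iff_eq_empty] at hE
    simp [hE] at h1
    omega
  obtain ⟨p, hpE, hp⟩ := Finset.exists_max_image E (fun p => (W p).card) hne
  refine ⟨p.1, p.2, by simpa [E] using hpE, ?_⟩
  have h2 : (E.biUnion W).card ≤ E.card * (W p).card := Finset.card_biUnion_le_card_mul _ _ _ hp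
  have h3 : E.card ≤ Fintype.card U ^ 2 := by
    refine (Finset.card_le_univ _).trans ?_
    rw [Fintype.card_prod, sq]
  have h4 : {f : U → V | Function.Injective f ∧
        (∀ u v, F.Adj u v → G.Adj (f u) (f v)) ∧ f p.1 = a ∧ f p.2 = b}.ncard = (W p).card := by
    rw [← Set.ncard_coe_finset]
    congr 1
    ext f
    simp [W]
  rw [h4]
  exact h1.trans (h2.trans (Nat.mul_le_mul_right _ h3))

/-- Functions with prescribed ranges on a set `s` of arguments: some choice of the values on `s` is
shared by many of them. -/
lemma exists_fiber_card (W : Finset (U → V)) (hW : W.Nonempty)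
    (s : Finset U) (N : Finset V) (h : ∀ f ∈ W, ∀ k ∈ s, f k ∈ N) :
    ∃ f₀ ∈ W, ∃ T ⊆ W, (∀ f ∈ T, ∀ k ∈ s, f k = f₀ k) ∧ W.card ≤ N.card ^ s.card * T.card := by
  classical
  let T : (U → V) → Finset (U → V) := fun g => W.filter fun f : U → V => ∀ k ∈ s, f k = g k
  obtain ⟨f₀, hf₀, hmax⟩ := Finset.exists_max_image W (fun g => (T g).card) hW
  refine ⟨f₀, hf₀, T f₀, Finset.filter_subset _ _, fun f hf => (Finset.mem_filter.1 hf).2, ?_⟩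
  have h1 := Finset.card_le_mul_card_image (s := W) (f := fun (f : U → V) (k : s) => f k)
    (T f₀).card (by
      intro r hr
      obtain ⟨g, hg, rfl⟩ := Finset.mem_image.1 hr
      refine le_trans (Finset.card_le_card ?_) (hmax g hg)
      intro f hf
      rw [Finset.mem_filter] at hf
      exact Finset.mem_filter.2 ⟨hf.1, fun k hk => congrFun hf.2 ⟨k, hk⟩⟩)
  have h2 : (W.image fun (f : U → V) (k : s) => f k).card ≤ N.card ^ s.card := by
    have h3 : (W.image fun (f : U → V) (k : s) => f k) ⊆ Fintype.piFinset fun _ : s => N := by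
      intro r hr
      obtain ⟨g, hg, rfl⟩ := Finset.mem_image.1 hr
      exact Fintype.mem_piFinset.2 fun k => h g hg k k.2
    refine (Finset.card_le_card h3).trans ?_
    simp
  rw [mul_comm]
  exact h1.trans (Nat.mul_le_mul_left _ h2)

/-- In a graph in which the edge `ab` lies in `t` complete graphs on `ℓ` vertices, `a` and `b` have
many common neighbours. -/
lemma le_ncard_commonNeighbors_pow [Finite V] {G : SimpleGraph V} {a b : V} {ℓ t : ℕ} (ht : 0 < t)
    (h : t ≤ {H : G.Subgraph | s(a, b) ∈ H.edgeSet ∧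
      Nonempty ((⊤ : SimpleGraph (Fin ℓ)) ≃g H.coe)}.ncard) :
    t ≤ ℓ ^ 2 * (G.commonNeighbors a b).ncard ^ (ℓ - 2) := by
  classical
  obtain ⟨i, j, hij, hW⟩ := exists_many_copies ht h
  rw [Fintype.card_fin] at hW
  set W := {f : Fin ℓ → V | Function.Injective f ∧
        (∀ u v, (⊤ : SimpleGraph (Fin ℓ)).Adj u v → G.Adj (f u) (f v)) ∧ f i = a ∧ f j = b} with hWd
  have hfin : W.Finite := Set.toFinite _
  have hNfin : (G.commonNeighbors a b).Finite := Set.toFinite _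
  rw [Set.ncard_eq_toFinset_card W hfin] at hW
  rw [Set.ncard_eq_toFinset_card _ hNfin]
  have hne : hfin.toFinset.Nonempty := by
    rw [Finset.nonempty_iff_ne_empty]
    intro h0
    simp [h0] at hW
    omega
  obtain ⟨f₀, hf₀, T, hTW, hT, hc⟩ := exists_fiber_card hfin.toFinset hne (Finset.univ \ {i, j})
    hNfin.toFinset (by
      intro f hf k hk
      rw [Set.Finite.mem_toFinset] at hf ⊢
      obtain ⟨-, hadj, rfl, rfl⟩ := hf
      simp only [Finset.mem_sdiff, Finset.mem_univ, Finset.mem_insert, Finset.mem_singleton,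
        true_and, not_or] at hk
      exact ⟨hadj _ _ (Ne.symm hk.1), hadj _ _ (Ne.symm hk.2)⟩)
  have h1 : T.card ≤ 1 := by
    rw [Finset.card_le_one]
    have key : ∀ f ∈ T, f = f₀ := by
      intro f hf
      have hfW := hTW hf
      rw [Set.Finite.mem_toFinset] at hf₀ hfW
      funext k
      by_cases hki : k = i
      · rw [hki, hfW.2.2.1, hf₀.2.2.1]
      by_cases hkj : k = j
      · rw [hkj, hfW.2.2.2, hf₀.2.2.2]
      exact hT f hf k (by simp [hki, hkj])
    intro f hf g hg
    rw [key f hf, key g hg]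
  have h2 : (Finset.univ \ {i, j} : Finset (Fin ℓ)).card = ℓ - 2 := by
    rw [Finset.card_univ_sdiff, Fintype.card_fin, Finset.card_pair hij]
  rw [h2] at hc
  refine hW.trans (Nat.mul_le_mul_left _ (hc.trans ?_))
  exact (Nat.mul_le_mul_left _ h1).trans_eq (mul_one _)

/-- If the edge `ab` lies in `t` copies of the complete graph minus the edge `xy`, but has few
common neighbours, then by pigeonhole many of these copies differ only in the image of one of `x` and
`y`. The images of the vertices other than `x` and `y` thus have many common neighbours. -/
lemma exists_many_commonNeighbors [Finite V] {G : SimpleGraph V} {a b : V} {ℓ t : ℕ} (ht : 0 < t)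
    {x y : Fin ℓ} {K : SimpleGraph (Fin ℓ)}
    (hK : ∀ u v, K.Adj u v ↔ u ≠ v ∧ s(u, v) ≠ s(x, y)) (hxy : x ≠ y)
    (h : t ≤ {H : G.Subgraph | s(a, b) ∈ H.edgeSet ∧ Nonempty (K ≃g H.coe)}.ncard) :
    ∃ f : Fin ℓ → V, Function.Injective f ∧
      t ≤ ℓ ^ 2 * ((G.commonNeighbors a b).ncard ^ (ℓ - 3) *
        {z | ∀ k, k ≠ x → k ≠ y → G.Adj z (f k)}.ncard) := by
  classical
  obtain ⟨i, j, hij, hW⟩ := exists_many_copies ht h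
  -- one of the two non-adjacent vertices of `K` is not an end of `ij`
  wlog hy : y ≠ i ∧ y ≠ j generalizing x y
  · have hx : x ≠ i ∧ x ≠ j := by
      have h1 := (hK i j).1 hij
      simp only [ne_eq, Sym2.eq_iff, not_or, not_and] at h1 hy ⊢
      refine ⟨?_, ?_⟩
      · rintro rfl
        have := h1.2.1 rfl
        exact hy (fun h => hxy h.symm) (fun h => this h.symm)
      · rintro rfl
        by_cases hyi : y = i
        · exact h1.2.2 hyi.symm rfl
        · exact hy hyi (fun h => hxy h.symm)
    obtain ⟨f, h1, h3⟩ := this (x := y) (y := x)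
      (fun u v => by rw [hK, Sym2.eq_swap (a := x)]) hxy.symm hx
    refine ⟨f, h1, ?_⟩
    have h4 : {z | ∀ k, k ≠ y → k ≠ x → G.Adj z (f k)} =
        {z | ∀ k, k ≠ x → k ≠ y → G.Adj z (f k)} := by
      ext z
      exact forall_congr' fun k => ⟨fun h a b => h b a, fun h a b => h b a⟩
    rwa [h4] at h3
  rw [Fintype.card_fin] at hW
  set W := {f : Fin ℓ → V | Function.Injective f ∧
        (∀ u v, K.Adj u v → G.Adj (f u) (f v)) ∧ f i = a ∧ f j = b} with hWd
  have hfin : W.Finite := Set.toFinite _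
  have hNfin : (G.commonNeighbors a b).Finite := Set.toFinite _
  rw [Set.ncard_eq_toFinset_card W hfin] at hW
  rw [Set.ncard_eq_toFinset_card _ hNfin]
  have hne : hfin.toFinset.Nonempty := by
    rw [Finset.nonempty_iff_ne_empty]
    intro h0
    simp [h0] at hW
    omega
  -- as `y` is neither `i` nor `j`, any vertex other than `i`, `j`, `y` is adjacent to both `i` and `j`
  obtain ⟨f₀, hf₀, T, hTW, hT, hc⟩ := exists_fiber_card hfin.toFinset hne (Finset.univ \ {i, j, y})
    hNfin.toFinset (by
      intro f hf k hk
      rw [Set.Finite.mem_toFinset] at hf ⊢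
      obtain ⟨-, hadj, rfl, rfl⟩ := hf
      simp only [Finset.mem_sdiff, Finset.mem_univ, Finset.mem_insert, Finset.mem_singleton,
        true_and, not_or] at hk
      have hKk : ∀ i, k ≠ i → y ≠ i → K.Adj i k := by
        intro i hki hyi
        rw [hK]
        refine ⟨Ne.symm hki, ?_⟩
        rw [ne_eq, Sym2.eq_iff]
        rintro (⟨-, h2⟩ | ⟨h1, -⟩)
        · exact hk.2.2 h2
        · exact hyi h1.symm
      exact ⟨hadj _ _ (hKk i hk.1 hy.1), hadj _ _ (hKk j hk.2.1 hy.2)⟩)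
  rw [Set.Finite.mem_toFinset] at hf₀
  have h2 : (Finset.univ \ {i, j, y} : Finset (Fin ℓ)).card = ℓ - 3 := by
    rw [Finset.card_univ_sdiff, Fintype.card_fin, Finset.card_eq_three.2
      ⟨i, j, y, hij.ne, hy.1.symm, hy.2.symm, rfl⟩]
  rw [h2] at hc
  refine ⟨f₀, hf₀.1, hW.trans (Nat.mul_le_mul_left _ (hc.trans
    (Nat.mul_le_mul_left _ ?_)))⟩
  rw [← Set.ncard_coe_finset]
  -- the functions in the fibre differ only in their value at `y`
  have key : ∀ f ∈ T, f ∈ W ∧ ∀ k, k ≠ y → f k = f₀ k := by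
    intro f hf
    have hfW := hTW hf
    rw [Set.Finite.mem_toFinset] at hfW
    refine ⟨hfW, fun k hky => ?_⟩
    by_cases hki : k = i
    · rw [hki, hfW.2.2.1, hf₀.2.2.1]
    by_cases hkj : k = j
    · rw [hkj, hfW.2.2.2, hf₀.2.2.2]
    exact hT f hf k (by simp [hki, hkj, hky])
  refine Set.ncard_le_ncard_of_injOn (fun f => f y) ?_ ?_ (Set.toFinite _)
  · intro f hf k hkx hky
    obtain ⟨hfW, hfk⟩ := key f hf
    rw [← hfk k hky]
    refine hfW.2.1 _ _ ((hK _ _).2 ⟨Ne.symm hky, ?_⟩)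
    rw [ne_eq, Sym2.eq_iff]
    rintro (⟨h1, -⟩ | ⟨-, h1⟩)
    · exact hxy h1.symm
    · exact hkx h1
  · intro f hf g hg hfg
    obtain ⟨-, hfk⟩ := key f hf
    obtain ⟨-, hgk⟩ := key g hg
    funext k
    by_cases hk : k = y
    · exact hk ▸ hfg
    · rw [hfk k hk, hgk k hk]

/-! ### Subdivisions on few vertices and their common neighbours -/

/-- Consider the images under `f` of the vertices of `K` other than the two non-adjacent ones `x` and
`y`. Any set of `C(ℓ - 2, 2) + 2` common neighbours of these images is used up by a subdivision of
`K`, in which two of the common neighbours are the branch vertices of `x` and `y`, and each other one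
subdivides an edge of `K` that contains neither `x` nor `y`. -/
lemma choose_le_maxSubdivisions [Finite V] {G : SimpleGraph V} {ℓ : ℕ}
    {x y : Fin ℓ} {K : SimpleGraph (Fin ℓ)}
    (hK : ∀ u v, K.Adj u v ↔ u ≠ v ∧ s(u, v) ≠ s(x, y)) (hxy : x ≠ y)
    {f : Fin ℓ → V} (hf : Function.Injective f) :
    {z | ∀ k, k ≠ x → k ≠ y → G.Adj z (f k)}.ncard.choose ((ℓ - 2).choose 2 + 2) ≤
      maxSubdivisions K G := by
  classical
  have hfin : {z | ∀ k, k ≠ x → k ≠ y → G.Adj z (f k)}.Finite := Set.toFinite _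
  rw [Set.ncard_eq_toFinset_card _ hfin]
  set B := hfin.toFinset with hBd
  have hB : ∀ z, z ∈ B ↔ ∀ k, k ≠ x → k ≠ y → G.Adj z (f k) := fun z => by simp [hBd]
  set A : Finset (Fin ℓ) := Finset.univ \ {x, y} with hAd
  have hA : ∀ k, k ∈ A ↔ k ≠ x ∧ k ≠ y := fun k => by simp [hAd]
  have hAB : ∀ k ∈ A, f k ∉ B := fun k hk h =>
    G.irrefl ((hB _).1 h k ((hA k).1 hk).1 ((hA k).1 hk).2)
  -- the index set of the vertices used in `B`: the pairs within `A`, and a loop at each of `x`, `y`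
  set J : Finset (Sym2 (Fin ℓ)) :=
    A.offDiag.image (fun p => s(p.1, p.2)) ∪ {s(x, x), s(y, y)} with hJd
  have hJx : s(x, x) ∈ J := by simp [hJd]
  have hJy : s(y, y) ∈ J := by simp [hJd]
  have hJA : ∀ u v, u ≠ v → u ∈ A → v ∈ A → s(u, v) ∈ J := by
    intro u v huv hu hv
    refine Finset.mem_union_left _ (Finset.mem_image.2 ⟨(u, v), ?_, rfl⟩)
    exact Finset.mem_offDiag.2 ⟨hu, hv, huv⟩
  have hJ : ∀ e ∈ J, e = s(x, x) ∨ e = s(y, y) ∨ ∃ u v, u ≠ v ∧ u ∈ A ∧ v ∈ A ∧ e = s(u, v) := by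
    intro e he
    rcases Finset.mem_union.1 he with he | he
    · obtain ⟨⟨u, v⟩, huv, rfl⟩ := Finset.mem_image.1 he
      rw [Finset.mem_offDiag] at huv
      exact Or.inr (Or.inr ⟨u, v, huv.2.2, huv.1, huv.2.1, rfl⟩)
    · simp only [Finset.mem_insert, Finset.mem_singleton] at he
      tauto
  have hJc : J.card = (ℓ - 2).choose 2 + 2 := by
    rw [hJd, Finset.card_union_of_disjoint]
    · congr 1
      · have h1 := Sym2.card_image_offDiag A
        rw [show A.card = ℓ - 2 by
          rw [hAd, Finset.card_univ_sdiff, Fintype.card_fin, Finset.card_pair hxy]] at h1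
        exact h1
      · exact Finset.card_pair (by simpa [Sym2.eq_iff] using hxy)
    · rw [Finset.disjoint_left]
      intro e he he'
      obtain ⟨⟨u, v⟩, huv, rfl⟩ := Finset.mem_image.1 he
      rw [Finset.mem_offDiag] at huv
      simp only [Finset.mem_insert, Finset.mem_singleton, Sym2.eq_iff, or_self] at he'
      rcases he' with ⟨h1, h2⟩ | ⟨h1, h2⟩
      all_goals exact huv.2.2 (h1.trans h2.symm)
  clear_value A J B
  rw [← hJc, ← Finset.card_powersetCard]
  have hinj : Set.InjOn (fun s : Finset V => f '' A ∪ (s : Set V))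
      (B.powersetCard J.card : Set (Finset V)) := by
    have key : ∀ s ∈ B.powersetCard J.card, (s : Set V) = (f '' A ∪ (s : Set V)) \ f '' A := by
      intro s hs
      rw [Set.union_sdiff_left, eq_comm, sdiff_eq_left, Set.disjoint_left]
      rintro z hz ⟨k, hk, rfl⟩
      exact hAB k hk ((Finset.mem_powersetCard.1 hs).1 hz)
    intro s hs s' hs' h
    have h' : (f '' A ∪ (s : Set V)) = f '' A ∪ (s' : Set V) := h
    apply Finset.coe_injective
    rw [key s hs, key s' hs', h']
  rw [← Finset.card_image_of_injOn hinj]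
  refine card_le_maxSubdivisions _ ?_
  intro r hr
  obtain ⟨s, hs, rfl⟩ := Finset.mem_image.1 hr
  obtain ⟨hsB, hsc⟩ := Finset.mem_powersetCard.1 hs
  -- a bijection from `J` to `s`
  obtain ⟨g, hgs, hginj, hgsurj⟩ : ∃ g : Sym2 (Fin ℓ) → V, (∀ e ∈ J, g e ∈ s) ∧
      (∀ e ∈ J, ∀ e' ∈ J, g e = g e' → e = e') ∧ ∀ z ∈ s, ∃ e ∈ J, g e = z := by
    let φ : J ≃ s := Finset.equivOfCardEq hsc.symm
    let g : Sym2 (Fin ℓ) → V := fun e => if h : e ∈ J then (φ ⟨e, h⟩).1 else f x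
    refine ⟨g, fun e he => by simp [g, he], ?_, ?_⟩
    · intro e he e' he' h
      simp only [g, he, he', dite_true] at h
      exact congrArg Subtype.val (φ.injective (Subtype.ext h))
    · intro z hz
      exact ⟨(φ.symm ⟨z, hz⟩).1, (φ.symm ⟨z, hz⟩).2, by simp [g]⟩
  have hgB : ∀ e ∈ J, g e ∈ B := fun e he => hsB (hgs e he)
  let br : Fin ℓ → V := fun u => if u ∈ A then f u else g s(u, u)
  have hdiag : ∀ u, u ∉ A → s(u, u) ∈ J := by
    intro u hu
    rw [hA, not_and_or, not_not, not_not] at hu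
    rcases hu with rfl | rfl
    exacts [hJx, hJy]
  have hbrA : ∀ u, u ∈ A → br u = f u := fun u hu => if_pos hu
  have hbrB : ∀ u, u ∉ A → br u = g s(u, u) := fun u hu => if_neg hu
  clear_value br
  have hbri : Function.Injective br := by
    intro u v huv
    by_cases hu : u ∈ A <;> by_cases hv : v ∈ A
    · rw [hbrA u hu, hbrA v hv] at huv
      exact hf huv
    · rw [hbrA u hu, hbrB v hv] at huv
      exact absurd (huv ▸ hgB _ (hdiag v hv)) (hAB u hu)
    · rw [hbrB u hu, hbrA v hv] at huv
      exact absurd (huv ▸ hgB _ (hdiag u hu)) (hAB v hv)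
    · rw [hbrB u hu, hbrB v hv] at huv
      have := hginj _ (hdiag u hu) _ (hdiag v hv) huv
      simpa [Sym2.eq_iff] using this
  let I : Sym2 (Fin ℓ) → Set V := fun e => {z | (∀ k ∈ e, k ∈ A) ∧ z = g e}
  have hIJ : ∀ e ∈ K.edgeSet, (∀ k ∈ e, k ∈ A) → e ∈ J := by
    intro e he heA
    induction e with
    | h u v => exact hJA u v (SimpleGraph.Adj.ne he) (heA u (by simp)) (heA v (by simp))
  obtain ⟨H, hH, hHv⟩ := exists_subdivision (F := K) (G := G) (br := br) hbri I
    (by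
      rintro e he u ⟨heA, hu⟩
      by_cases huA : u ∈ A
      · rw [hbrA u huA] at hu
        exact hAB u huA (hu ▸ hgB e (hIJ e he heA))
      · rw [hbrB u huA] at hu
        have := hginj _ (hdiag u huA) _ (hIJ e he heA) hu
        exact huA (heA u (by simp [← this])))
    (by
      intro e he e' he' hne
      rw [Set.disjoint_left]
      rintro z ⟨h1, rfl⟩ ⟨h2, h3⟩
      exact hne (hginj _ (hIJ e he h1) _ (hIJ e' he' h2) h3))
    (by
      intro u v huv h
      have huv' := (hK u v).1 h
      by_cases hu : u ∈ A <;> by_cases hv : v ∈ A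
      · have hJuv := hJA u v huv.ne hu hv
        have hu' := (hA u).1 hu
        have hv' := (hA v).1 hv
        have h1 : G.Adj (g s(u, v)) (br u) := by
          rw [hbrA u hu]
          exact (hB _).1 (hgB _ hJuv) u hu'.1 hu'.2
        have h2 : G.Adj (g s(u, v)) (br v) := by
          rw [hbrA v hv]
          exact (hB _).1 (hgB _ hJuv) v hv'.1 hv'.2
        refine ⟨.cons h1.symm (.cons h2 .nil), ?_, ?_⟩
        · rw [SimpleGraph.Walk.cons_isPath_iff, SimpleGraph.Walk.cons_isPath_iff]
          have h3 : br u ≠ br v := fun h => huv.ne (hbri h)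
          simpa [h2.ne, h1.ne'] using h3
        · intro w
          simp [I, hu, hv]
          tauto
      all_goals
        have h1 : G.Adj (br u) (br v) := by
          first
          | rw [hbrA u hu, hbrB v hv]
            exact ((hB _).1 (hgB _ (hdiag v hv)) u ((hA u).1 hu).1 ((hA u).1 hu).2).symm
          | rw [hbrA v hv, hbrB u hu]
            exact (hB _).1 (hgB _ (hdiag u hu)) v ((hA v).1 hv).1 ((hA v).1 hv).2
          | exfalso
            rw [hA, not_and_or, not_not, not_not] at hu hv
            rw [ne_eq, ne_eq, Sym2.eq_iff] at huv'
            rcases hu with rfl | rfl <;> rcases hv with rfl | rfl <;> simp at huv'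
        refine ⟨.cons h1 .nil, ?_, ?_⟩
        · rw [SimpleGraph.Walk.cons_isPath_iff]
          simpa using h1.ne
        · intro w
          simp [I, hu, hv])
  refine ⟨H, hH, ?_⟩
  rw [hHv]
  ext z
  constructor
  · rintro (⟨u, rfl⟩ | hz)
    · by_cases hu : u ∈ A
      · exact Or.inl ⟨u, hu, (hbrA u hu).symm⟩
      · exact Or.inr (hbrB u hu ▸ hgs _ (hdiag u hu))
    · obtain ⟨e, he, heA, rfl⟩ := Set.mem_iUnion₂.1 hz
      exact Or.inr (hgs _ (hIJ e he heA))
  · rintro (⟨u, hu, rfl⟩ | hz)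
    · exact Or.inl ⟨u, hbrA u hu⟩
    · obtain ⟨e, he, rfl⟩ := hgsurj z hz
      rcases hJ e he with rfl | rfl | ⟨u, v, huv, hu, hv, rfl⟩
      · exact Or.inl ⟨x, hbrB x (by simp [hA])⟩
      · exact Or.inl ⟨y, hbrB y (by simp [hA])⟩
      · refine Or.inr (Set.mem_biUnion (x := s(u, v)) ?_ ⟨by simp [hu, hv], rfl⟩)
        refine (hK u v).2 ⟨huv, ?_⟩
        rw [ne_eq, Sym2.eq_iff]
        rw [hA] at hu hv
        rintro (⟨h1, -⟩ | ⟨h1, -⟩)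
        · exact hu.1 h1
        · exact hu.2 h1

/-! ### Lower bounds for the minimum -/

lemma exists_equiv_map_pair {α β : Type*} (σ : α ≃ β) {i j : α} {a b : β} (hij : i ≠ j)
    (hab : a ≠ b) :
    ∃ τ : α ≃ β, τ i = a ∧ τ j = b := by
  classical
  let τ := σ.trans (Equiv.swap (σ i) a)
  have hτ : τ i = a := by simp [τ]
  refine ⟨τ.trans (Equiv.swap (τ j) b), ?_, by simp⟩
  rw [Equiv.trans_apply, hτ]
  exact Equiv.swap_apply_of_ne_of_ne (fun h => hij (τ.injective (hτ.trans h))) hab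

/-- A large complete graph is locally dense. -/
lemma locallyDense_completeGraph {ℓ : ℕ} (hℓ : 3 ≤ ℓ) {F : SimpleGraph (Fin ℓ)} (hF : F ≠ ⊥)
    (t : ℕ) : LocallyDense F t (⊤ : SimpleGraph (Fin (ℓ + t))) := by
  classical
  obtain ⟨i, j, hij⟩ := SimpleGraph.ne_bot_iff_exists_adj.1 hF
  obtain ⟨k, hk⟩ : ∃ k : Fin ℓ, k ∉ ({i, j} : Finset (Fin ℓ)) := by
    by_contra! h
    have h1 : (Finset.univ : Finset (Fin ℓ)) ⊆ {i, j} := fun k _ => h k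
    have h2 := Finset.card_le_card h1
    rw [Finset.card_univ, Fintype.card_fin] at h2
    have := Finset.card_le_two (a := i) (b := j)
    omega
  simp only [Finset.mem_insert, Finset.mem_singleton, not_or] at hk
  intro e he
  induction e with
  | h a b =>
    have hab : a ≠ b := he
    -- an embedding of `Fin ℓ` that maps `i` to `a` and `j` to `b`
    obtain ⟨g, hga, hgb⟩ : ∃ g : Fin ℓ ↪ Fin (ℓ + t), g i = a ∧ g j = b := by
      obtain ⟨τ, hi, hj⟩ := exists_equiv_map_pair (Equiv.refl (Fin (ℓ + t)))
        ((Fin.castAddEmb t).injective.ne hij.ne) hab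
      exact ⟨(Fin.castAddEmb t).trans τ.toEmbedding, hi, hj⟩
    have hRc : (Finset.univ \ Finset.univ.map g).card = t := by
      simp [Finset.card_univ_sdiff]
    have h1 := card_le_ncard_copies_of_update (F := F) (G := ⊤) (a := a) (b := b) g.injective k
      (Finset.univ \ Finset.univ.map g)
      (by
        rintro z hz u - rfl
        simp at hz)
      (by
        intro u v huv _ _
        rw [SimpleGraph.top_adj, ne_eq, g.injective.eq_iff]
        exact huv.ne)
      (by
        rintro z hz u - rfl
        simp at hz)
      ⟨i, j, hij, Ne.symm hk.1, Ne.symm hk.2, hga, hgb⟩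
    rwa [hRc] at h1

lemma le_minSubdivisions {ℓ : ℕ} (hℓ : 3 ≤ ℓ) {F : SimpleGraph (Fin ℓ)} (hF : F ≠ ⊥) {t : ℕ} {r : ℝ}
    (h : ∀ (V : Type) (_ : Finite V) (G : SimpleGraph V), G ≠ ⊥ → LocallyDense F t G →
      r ≤ maxSubdivisions F G) : r ≤ minSubdivisions F t := by
  have hne : {n : ℕ | ∃ (V : Type) (_ : Finite V) (G : SimpleGraph V),
      G ≠ ⊥ ∧ LocallyDense F t G ∧ maxSubdivisions F G = n}.Nonempty := by
    refine ⟨_, Fin (ℓ + t), inferInstance, ⊤, ?_, locallyDense_completeGraph hℓ hF t, rfl⟩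
    have : Nontrivial (Fin (ℓ + t)) := Fin.nontrivial_iff_two_le.2 (by omega)
    exact top_ne_bot
  obtain ⟨V, hV, G, hG, hd, hm⟩ := Nat.sInf_mem hne
  have h1 := h V hV G hG hd
  rw [hm] at h1
  exact h1

/-! ### Asymptotics -/

lemma exists_copy_of_locallyDense [Finite V] {F : SimpleGraph U} {G : SimpleGraph V} {t : ℕ}
    (ht : 0 < t) (hG : G ≠ ⊥) (hd : LocallyDense F t G) : Nonempty (F.Copy G) := by
  obtain ⟨a, b, hab⟩ := SimpleGraph.ne_bot_iff_exists_adj.1 hG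
  obtain ⟨H, -, ⟨φ⟩⟩ := Set.nonempty_of_ncard_ne_zero (ht.trans_le (hd s(a, b) hab)).ne'
  exact ⟨H.coeCopy.comp φ.toCopy⟩

lemma top_ne_bot_of_three_le {ℓ : ℕ} (hℓ : 3 ≤ ℓ) : (⊤ : SimpleGraph (Fin ℓ)) ≠ ⊥ := by
  have : Nontrivial (Fin ℓ) := Fin.nontrivial_iff_two_le.2 (by omega)
  exact top_ne_bot

lemma two_rpow_le_minSubdivisions_top {ℓ : ℕ} (hℓ : 3 ≤ ℓ) :
    ∃ t₀ : ℕ, ∀ t : ℕ, t₀ ≤ t → (2 : ℝ) ^ ((t : ℝ) ^ (1 / (2 * ((ℓ : ℝ) - 2)))) ≤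
      (minSubdivisions (⊤ : SimpleGraph (Fin ℓ)) t : ℝ) := by
  have hℓ' : (3 : ℝ) ≤ ℓ := by exact_mod_cast hℓ
  have hc : 0 < 1 / (2 * ((ℓ : ℝ) - 2)) := by
    apply one_div_pos.2
    linarith
  obtain ⟨t₀, ht₀⟩ := Filter.eventually_atTop.1
    (((tendsto_rpow_atTop hc).comp tendsto_natCast_atTop_atTop).eventually_ge_atTop
      (4 * (ℓ : ℝ) ^ 3))
  refine ⟨t₀ + 1, fun t ht => ?_⟩
  have hr : 4 * (ℓ : ℝ) ^ 3 ≤ (t : ℝ) ^ (1 / (2 * ((ℓ : ℝ) - 2))) := ht₀ t (by omega)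
  have htpos : 0 < t := by omega
  set r := (t : ℝ) ^ (1 / (2 * ((ℓ : ℝ) - 2))) with hrd
  have hrpos : 0 ≤ r := by positivity
  have hrt : (r ^ 2) ^ (ℓ - 2) = t := by
    rw [← pow_mul, hrd, ← Real.rpow_natCast, ← Real.rpow_mul (by positivity)]
    push_cast [Nat.cast_sub (show 2 ≤ ℓ by omega)]
    rw [one_div_mul_cancel (by linarith), Real.rpow_one]
  refine le_minSubdivisions hℓ (top_ne_bot_of_three_le hℓ) ?_
  intro V hV G hG hd
  obtain ⟨f⟩ := exists_copy_of_locallyDense htpos hG hd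
  have hcod : ∀ u v, G.Adj u v → ⌈r ^ 2 / (ℓ : ℝ) ^ 2⌉₊ ≤ (G.commonNeighbors u v).ncard := by
    intro u v huv
    rw [Nat.ceil_le]
    have h1 := le_ncard_commonNeighbors_pow htpos (hd s(u, v) huv)
    set D := (G.commonNeighbors u v).ncard
    have h2 : (t : ℝ) ≤ (ℓ : ℝ) ^ 2 * (D : ℝ) ^ (ℓ - 2) := by exact_mod_cast h1
    refine le_of_pow_le_pow_left₀ (n := ℓ - 2) (by omega) (by positivity) ?_
    rw [div_pow, hrt, div_le_iff₀ (by positivity), mul_comm]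
    refine h2.trans ?_
    gcongr
    refine le_self_pow₀ ?_ (by omega)
    nlinarith
  set D := ⌈r ^ 2 / (ℓ : ℝ) ^ 2⌉₊ with hD
  have hDr : r ^ 2 / (ℓ : ℝ) ^ 2 ≤ D := Nat.le_ceil _
  have h1 : 2 * r + ℓ + 1 ≤ D := by
    refine le_trans ?_ hDr
    rw [le_div_iff₀ (by positivity)]
    have h2 : (ℓ : ℝ) ^ 2 * (2 * r + ℓ + 1) ≤ (ℓ : ℝ) ^ 2 * (4 * ℓ * r) := by
      gcongr
      have : (ℓ : ℝ) ≤ 4 * ℓ ^ 3 := by nlinarith [sq_nonneg (ℓ : ℝ)]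
      nlinarith
    nlinarith
  have h2 : (ℓ : ℝ) ≤ D := by linarith
  have h3 : ℓ ≤ D := by exact_mod_cast h2
  have hab : (⊤ : SimpleGraph (Fin ℓ)).Adj ⟨0, by omega⟩ ⟨1, by omega⟩ := by simp
  have h4 := two_pow_le_maxSubdivisions f hab (n := (D - ℓ) / 2) hcod
    (by rw [Fintype.card_fin]; omega)
  have h5 : r ≤ ((D - ℓ) / 2 : ℕ) := by
    have h6 : D ≤ 2 * ((D - ℓ) / 2) + 1 + ℓ := by omega
    have h7 : (D : ℝ) ≤ 2 * ((D - ℓ) / 2 : ℕ) + 1 + ℓ := by exact_mod_cast h6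
    linarith
  calc (2 : ℝ) ^ r ≤ (2 : ℝ) ^ (((D - ℓ) / 2 : ℕ) : ℝ) :=
        Real.rpow_le_rpow_of_exponent_le (by norm_num) h5
    _ = ((2 ^ ((D - ℓ) / 2) : ℕ) : ℝ) := by rw [Real.rpow_natCast]; push_cast; rfl
    _ ≤ _ := by exact_mod_cast h4

/-- Powers of the binary logarithm are eventually smaller than the identity. -/
lemma eventually_mul_log_pow_le (C k : ℕ) :
    ∃ t₀ : ℕ, ∀ t : ℕ, t₀ ≤ t → C * (Nat.log 2 t + 1) ^ k ≤ t := by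
  have h1 : Filter.Tendsto (fun n : ℕ => (n : ℝ) ^ k / (2 : ℝ) ^ n) Filter.atTop (nhds 0) :=
    tendsto_pow_const_div_const_pow_of_one_lt k (by norm_num)
  obtain ⟨n₀, hn₀⟩ := Filter.eventually_atTop.1
    (h1.eventually_le_const (show (0 : ℝ) < 1 / (2 * (C + 1)) by positivity))
  refine ⟨2 ^ n₀, fun t ht => ?_⟩
  have htne : t ≠ 0 := (lt_of_lt_of_le (by positivity) ht).ne'
  have h2 : n₀ ≤ Nat.log 2 t := Nat.le_log_of_pow_le (by norm_num) ht
  have h3 := hn₀ (Nat.log 2 t + 1) (by omega)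
  rw [div_le_div_iff₀ (by positivity) (by positivity), one_mul] at h3
  have h4 : (Nat.log 2 t + 1) ^ k * (2 * (C + 1)) ≤ 2 ^ (Nat.log 2 t + 1) := by exact_mod_cast h3
  have h5 : 2 ^ Nat.log 2 t ≤ t := Nat.pow_log_le_self 2 htne
  rw [pow_succ 2] at h4
  nlinarith [Nat.zero_le ((Nat.log 2 t + 1) ^ k)]

/-- If `n` is at least `t` up to a factor that is polylogarithmic in `t`, then the number of
`(M + 1)`-subsets of an `n`-set is at least `t ^ M`. -/
lemma exists_pow_le_choose (M c d k : ℕ) :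
    ∃ t₀ : ℕ, ∀ t n : ℕ, t₀ ≤ t →
      t ≤ c * (d * (Nat.log 2 t + 1)) ^ k * n → t ^ M ≤ n.choose (M + 1) := by
  obtain ⟨t₁, h₁⟩ := eventually_mul_log_pow_le ((2 * (c * d ^ k)) ^ (M + 1) * (M + 1).factorial)
    (k * (M + 1))
  obtain ⟨t₂, h₂⟩ := eventually_mul_log_pow_le (c * d ^ k * (2 * M)) k
  refine ⟨max (max t₁ t₂) 1, fun t n ht hn => ?_⟩
  have h₁ := h₁ t (by omega)
  have h₂ := h₂ t (by omega)
  have htpos : 0 < t := by omega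
  set L := Nat.log 2 t + 1
  set q := c * (d * L) ^ k with hq
  have h₁' : (2 * q) ^ (M + 1) * (M + 1).factorial ≤ t := by
    refine le_of_eq_of_le ?_ h₁
    rw [hq, pow_mul, mul_pow d, ← mul_assoc c, ← mul_assoc 2, mul_pow _ (L ^ k)]
    ring
  have h₂' : q * (2 * M) ≤ t := by
    refine le_of_eq_of_le ?_ h₂
    rw [hq, mul_pow]
    ring
  have hqpos : 0 < q := by
    rcases Nat.eq_zero_or_pos q with h0 | h0
    · rw [h0] at hn
      omega
    · exact h0
  have h3 : 2 * M ≤ n := Nat.le_of_mul_le_mul_left (h₂'.trans hn) hqpos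
  have h4 : t ≤ 2 * q * (n - M) := by
    refine hn.trans ?_
    rw [mul_comm 2 q, mul_assoc q 2]
    exact Nat.mul_le_mul_left _ (by omega)
  have h5 : ((n - M) ^ (M + 1) : ℕ) ≤ (M + 1).factorial * n.choose (M + 1) := by
    have h6 := Nat.pow_le_choose (α := ℝ) (M + 1) n
    rw [div_le_iff₀ (by positivity), Nat.add_sub_add_right] at h6
    rw [mul_comm]
    exact_mod_cast h6
  -- `t ^ (M + 1) ≤ (2q)^(M+1) (n-M)^(M+1) ≤ (2q)^(M+1) (M+1)! C(n, M+1) ≤ t C(n, M+1)`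
  have h7 : t * t ^ M ≤ t * n.choose (M + 1) := by
    calc t * t ^ M = t ^ (M + 1) := by ring
      _ ≤ (2 * q * (n - M)) ^ (M + 1) := Nat.pow_le_pow_left h4 _
      _ = (2 * q) ^ (M + 1) * (n - M) ^ (M + 1) := mul_pow _ _ _
      _ ≤ (2 * q) ^ (M + 1) * ((M + 1).factorial * n.choose (M + 1)) := Nat.mul_le_mul_left _ h5
      _ = ((2 * q) ^ (M + 1) * (M + 1).factorial) * n.choose (M + 1) := by ring
      _ ≤ t * n.choose (M + 1) := Nat.mul_le_mul_right _ h₁'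
  exact Nat.le_of_mul_le_mul_left h7 htpos

lemma pow_le_minSubdivisions_deleteEdge {ℓ : ℕ} (hℓ : 4 ≤ ℓ) :
    ∃ t₀ : ℕ, ∀ t : ℕ, t₀ ≤ t → ∀ x y : Fin ℓ, x ≠ y → ∀ K : SimpleGraph (Fin ℓ),
      (∀ u v, K.Adj u v ↔ u ≠ v ∧ s(u, v) ≠ s(x, y)) →
        t ^ ((ℓ - 2).choose 2 + 1) ≤ minSubdivisions K t := by
  set M := (ℓ - 2).choose 2 + 1 with hM
  obtain ⟨t₀, ht₀⟩ := exists_pow_le_choose M (ℓ ^ 2) (ℓ + 2 * M) (ℓ - 3)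
  refine ⟨t₀ + 1, fun t ht x y hxy K hK => ?_⟩
  have htpos : 0 < t := by omega
  obtain ⟨z, hz⟩ : ∃ z : Fin ℓ, z ∉ ({x, y} : Finset (Fin ℓ)) := by
    by_contra! h
    have h1 : (Finset.univ : Finset (Fin ℓ)) ⊆ {x, y} := fun k _ => h k
    have h2 := Finset.card_le_card h1
    rw [Finset.card_univ, Fintype.card_fin] at h2
    have := Finset.card_le_two (a := x) (b := y)
    omega
  simp only [Finset.mem_insert, Finset.mem_singleton, not_or] at hz
  have hxz : K.Adj x z := by
    refine (hK x z).2 ⟨Ne.symm hz.1, ?_⟩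
    rw [ne_eq, Sym2.eq_iff]
    rintro (⟨-, h⟩ | ⟨h, -⟩)
    · exact hz.2 h
    · exact hxy h
  have hKne : K ≠ ⊥ := SimpleGraph.ne_bot_iff_exists_adj.2 ⟨x, z, hxz⟩
  have goal : ((t ^ M : ℕ) : ℝ) ≤ minSubdivisions K t := by
    refine le_minSubdivisions (by omega) hKne ?_
    intro V hV G hG hd
    rw [Nat.cast_le]
    obtain ⟨f⟩ := exists_copy_of_locallyDense htpos hG hd
    set L := Nat.log 2 t + 1 with hL
    by_cases hcod : ∀ u v, G.Adj u v → ℓ + 2 * (M * L) ≤ (G.commonNeighbors u v).ncard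
    · refine le_trans ?_ (two_pow_le_maxSubdivisions f hxz (n := M * L) hcod
        (by rw [Fintype.card_fin]))
      rw [mul_comm, pow_mul]
      exact Nat.pow_le_pow_left (Nat.lt_pow_succ_log_self (by norm_num) t).le _
    · push Not at hcod
      obtain ⟨a, b, hab, hlt⟩ := hcod
      obtain ⟨f, hf, hB⟩ := exists_many_commonNeighbors htpos hK hxy (hd s(a, b) hab)
      refine le_trans (ht₀ t _ (by omega) (hB.trans ?_)) (choose_le_maxSubdivisions hK hxy hf)
      rw [mul_assoc]
      refine Nat.mul_le_mul_left _ (Nat.mul_le_mul_right _ (Nat.pow_le_pow_left ?_ _))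
      refine hlt.le.trans ?_
      have : 1 ≤ L := by omega
      nlinarith
  exact_mod_cast goal

lemma ncard_edgeSet_deleteEdge {ℓ : ℕ} (hℓ : 4 ≤ ℓ) {e : Sym2 (Fin ℓ)}
    (he : e ∈ (⊤ : SimpleGraph (Fin ℓ)).edgeSet) :
    (((⊤ : SimpleGraph (Fin ℓ)).deleteEdges {e}).edgeSet.ncard : ℝ) - 2 * ℓ + 5 =
      ((ℓ - 2).choose 2 + 1 : ℕ) := by
  have h1 : (⊤ : SimpleGraph (Fin ℓ)).edgeSet.ncard = ℓ.choose 2 := by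
    rw [← SimpleGraph.coe_edgeFinset, Set.ncard_coe_finset,
      SimpleGraph.card_edgeFinset_top_eq_card_choose_two, Fintype.card_fin]
  have h2 := Set.ncard_sdiff_singleton_add_one he
  rw [h1, ← SimpleGraph.edgeSet_deleteEdges] at h2
  have h3 : ℓ.choose 2 = (ℓ - 2).choose 2 + (2 * ℓ - 3) := by
    obtain ⟨k, rfl⟩ := Nat.exists_eq_add_of_le' hℓ
    rw [show k + 4 - 2 = k + 2 by omega, Nat.choose_succ_succ' (k + 3) 1,
      Nat.choose_succ_succ' (k + 2) 1, Nat.choose_one_right, Nat.choose_one_right, one_add_one_eq_two]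
    omega
  have h4 : ((⊤ : SimpleGraph (Fin ℓ)).deleteEdges {e}).edgeSet.ncard + 5 =
      (ℓ - 2).choose 2 + 1 + 2 * ℓ := by omega
  have h5 : (((⊤ : SimpleGraph (Fin ℓ)).deleteEdges {e}).edgeSet.ncard : ℝ) + 5 =
      ((ℓ - 2).choose 2 + 1 : ℕ) + 2 * ℓ := by exact_mod_cast h4
  linarith

/-! ### Few subdivisions in the join with an independent set -/

/-- In a subdivision `T` of `F`, an independent set `I` consists of at most `|U|` branch vertices and
of interior vertices of paths. The successor of such an interior vertex on its path lies outside `I`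
and determines the vertex, unless it is the last vertex of the path. -/
lemma Subdivision.ncard_le_of_independent {W : Type*} [LinearOrder U] [Finite U] [Finite W]
    {F : SimpleGraph U} {T : SimpleGraph W} (S : Subdivision F T) (I : Set W)
    (hI : ∀ a ∈ I, ∀ b ∈ I, ¬ T.Adj a b) :
    I.ncard ≤ F.edgeSet.ncard + Iᶜ.ncard + Nat.card U := by
  classical
  let br : U → W := fun u => S.branch u
  -- the path of an edge `uv` with `u < v`
  let P : ∀ u v : U, F.Adj u v → T.Walk (br u) (br v) := fun u v h => (S.path h).1
  have hP : ∀ u v h, (P u v h).IsPath := fun u v h => (S.path h).2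
  let R : W → F.edgeSet ⊕ (Iᶜ : Set W) → Prop := fun b =>
    Sum.elim
      (fun e => ∃ u v, u < v ∧ ∃ h : F.Adj u v, ∃ i, e.1 = s(u, v) ∧
        i + 1 = (P u v h).length ∧ (P u v h).getVert i = b)
      (fun w => w.1 ∉ Set.range br ∧ ∃ u v, u < v ∧ ∃ h : F.Adj u v, ∃ i,
        i + 1 ≤ (P u v h).length ∧ (P u v h).getVert i = b ∧ (P u v h).getVert (i + 1) = w.1)
  have hex : ∀ b : (I \ Set.range br : Set W), ∃ r, R b r := by
    rintro ⟨b, hbI, hbr'⟩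
    obtain ⟨u, v, huv, h, hb⟩ : ∃ u v, u < v ∧ ∃ h : F.Adj u v, b ∈ (P u v h).support := by
      rcases S.vertex_mem b with h | ⟨u, v, h, hb⟩
      · exact absurd h hbr'
      rcases lt_or_gt_of_ne h.ne with huv | huv
      · exact ⟨u, v, huv, h, hb⟩
      · refine ⟨v, u, huv, h.symm, ?_⟩
        change b ∈ (S.path h.symm).1.support
        rw [S.path_symm h, SimpleGraph.Path.reverse_coe, SimpleGraph.Walk.support_reverse,
          List.mem_reverse]
        exact hb
    obtain ⟨i, rfl, hi⟩ := SimpleGraph.Walk.mem_support_iff_exists_getVert.1 hb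
    have hil : i ≠ (P u v h).length := by
      rintro rfl
      exact hbr' ⟨v, by rw [SimpleGraph.Walk.getVert_length]⟩
    have hadj := (P u v h).adj_getVert_succ (lt_of_le_of_ne hi hil)
    by_cases hlast : i + 1 = (P u v h).length
    · exact ⟨Sum.inl ⟨s(u, v), h⟩, u, v, huv, h, i, rfl, hlast, rfl⟩
    · refine ⟨Sum.inr ⟨(P u v h).getVert (i + 1), fun hw => hI _ hbI _ hw hadj⟩, ?_, u, v, huv, h, i,
        by omega, rfl, rfl⟩
      rintro ⟨x, hx⟩
      have hmem : br x ∈ (P u v h).support := hx ▸ (P u v h).getVert_mem_support _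
      rcases S.eq_or_eq_of_branch_mem h x hmem with rfl | rfl
      · have h0 : (P x v h).getVert 0 = (P x v h).getVert (i + 1) := by
          rw [SimpleGraph.Walk.getVert_zero]
          exact hx
        have := (hP x v h).getVert_injOn (Nat.zero_le _) (show i + 1 ≤ _ by omega) h0
        omega
      · have h0 : (P u x h).getVert (P u x h).length = (P u x h).getVert (i + 1) := by
          rw [SimpleGraph.Walk.getVert_length]
          exact hx
        have := (hP u x h).getVert_injOn (le_refl (P u x h).length) (show i + 1 ≤ _ by omega) h0
        omega
  have horient : ∀ {u v u' v' : U}, u < v → u' < v' → s(u, v) = s(u', v') → u = u' ∧ v = v' := by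
    intro u v u' v' h h' he
    rcases Sym2.eq_iff.1 he with h1 | ⟨rfl, rfl⟩
    · exact h1
    · exact absurd h h'.not_gt
  have huniq : ∀ b b' r, R b r → R b' r → b = b' := by
    rintro b b' (e | w)
    · rintro ⟨u, v, huv, h, i, he, hi, rfl⟩ ⟨u', v', huv', h', i', he', hi', rfl⟩
      obtain ⟨rfl, rfl⟩ := horient huv huv' (he.symm.trans he')
      rw [show i = i' by omega]
    · rintro ⟨hw, u, v, huv, h, i, hi, rfl, hiw⟩ ⟨-, u', v', huv', h', i', hi', rfl, hiw'⟩
      have he : s(u, v) = s(u', v') := by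
        by_contra hne
        refine hw (S.disjoint h h' hne w.1 ?_ ?_)
        · exact hiw ▸ (P u v h).getVert_mem_support _
        · exact hiw' ▸ (P u' v' h').getVert_mem_support _
      obtain ⟨rfl, rfl⟩ := horient huv huv' he
      have := (hP u v h).getVert_injOn hi hi' (hiw.trans hiw'.symm)
      rw [show i = i' by omega]
  choose r hr using hex
  have h1 : (I \ Set.range br).ncard ≤ F.edgeSet.ncard + Iᶜ.ncard := by
    rw [← Nat.card_coe_set_eq, ← Nat.card_coe_set_eq, ← Nat.card_coe_set_eq, ← Nat.card_sum]
    exact Nat.card_le_card_of_injective r fun b b' h =>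
      Subtype.ext (huniq _ _ _ (hr b) (h ▸ hr b'))
  have h2 : (Set.range br).ncard ≤ Nat.card U := by
    rw [← Set.image_univ, ← Set.ncard_univ]
    exact Set.ncard_image_le
  have h3 := Set.ncard_le_ncard_sdiff_add_ncard I (Set.range br)
  omega

lemma joinIndependent_adj_inl_inl {A B : Type*} {H : SimpleGraph A} {a a' : A} :
    (joinIndependent H B).Adj (.inl a) (.inl a') ↔ H.Adj a a' := by
  simp [joinIndependent]

lemma joinIndependent_adj_inl_inr {A B : Type*} {H : SimpleGraph A} {a : A} {b : B} :
    (joinIndependent H B).Adj (.inl a) (.inr b) := by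
  simp [joinIndependent]

lemma not_joinIndependent_adj_inr_inr {A B : Type*} {H : SimpleGraph A} {b b' : B} :
    ¬ (joinIndependent H B).Adj (.inr b) (.inr b') := by
  simp [joinIndependent]

lemma ncard_inr_le_of_isSubdivision {A B : Type*} [Finite A] [Finite B] [LinearOrder U] [Finite U]
    {F : SimpleGraph U} {H : SimpleGraph A} (S : (joinIndependent H B).Subgraph)
    (hS : IsSubdivision F S.coe) :
    {b : B | Sum.inr b ∈ S.verts}.ncard ≤ F.edgeSet.ncard + Nat.card A + Nat.card U := by
  obtain ⟨T⟩ := hS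
  set I : Set S.verts := {w | ∃ b, w.1 = Sum.inr b} with hI
  have h1 := T.ncard_le_of_independent I (by
    rintro ⟨_, _⟩ ⟨b, rfl⟩ ⟨_, _⟩ ⟨b', rfl⟩ h
    exact not_joinIndependent_adj_inr_inr (S.adj_sub h))
  have h2 : {b : B | Sum.inr b ∈ S.verts}.ncard ≤ I.ncard := by
    rw [← Nat.card_coe_set_eq, ← Nat.card_coe_set_eq]
    refine Nat.card_le_card_of_injective (fun b => ⟨⟨.inr b.1, b.2⟩, b.1, rfl⟩) ?_
    intro b b' h
    exact Subtype.ext (Sum.inr_injective (congrArg (fun w => w.1.1) h))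
  have h3 : Iᶜ.ncard ≤ Nat.card A := by
    have h4 : ∀ w : (Iᶜ : Set S.verts), ∃ a, w.1.1 = Sum.inl a := by
      rintro ⟨⟨a | b, hw⟩, hwI⟩
      · exact ⟨a, rfl⟩
      · exact absurd ⟨b, rfl⟩ hwI
    choose a ha using h4
    rw [← Nat.card_coe_set_eq]
    refine Nat.card_le_card_of_injective a fun w w' h => ?_
    exact Subtype.ext (Subtype.ext (by rw [ha, ha, h]))
  omega

lemma maxSubdivisions_joinIndependent_le {A B : Type*} [Finite A] [Finite B] [LinearOrder U]
    [Finite U] (F : SimpleGraph U) (H : SimpleGraph A) :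
    maxSubdivisions F (joinIndependent H B) ≤
      2 ^ Nat.card A * (Nat.card B + 1) ^ (F.edgeSet.ncard + Nat.card A + Nat.card U) := by
  classical
  have := Fintype.ofFinite A
  have := Fintype.ofFinite B
  set m := F.edgeSet.ncard + Nat.card A + Nat.card U
  -- a set of at most `m` elements of `B` is the set of values of a function `Fin m → Option B`
  let c : Finset A × (Fin m → Option B) → Set (A ⊕ B) := fun p =>
    {z | Sum.elim (fun a => a ∈ p.1) (fun b => ∃ i, p.2 i = some b) z}
  refine (maxSubdivisions_le (Finset.univ.image c) ?_).trans ?_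
  · intro S hS
    have hm := ncard_inr_le_of_isSubdivision S hS
    have hfin : {b : B | Sum.inr b ∈ S.verts}.Finite := Set.toFinite _
    rw [Set.ncard_eq_toFinset_card _ hfin] at hm
    refine Finset.mem_image.2 ⟨(Finset.univ.filter fun a => Sum.inl a ∈ S.verts,
      fun i => hfin.toFinset.toList[i]?), Finset.mem_univ _, ?_⟩
    ext z
    rcases z with a | b
    · simp [c]
    · have hb : Sum.inr b ∈ S.verts ↔ b ∈ hfin.toFinset.toList := by simp
      rw [hb]
      change (∃ i : Fin m, hfin.toFinset.toList[i]? = some b) ↔ _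
      rw [List.mem_iff_getElem?]
      constructor
      · rintro ⟨i, hi⟩
        exact ⟨i, hi⟩
      · rintro ⟨i, hi⟩
        have hlt : i < hfin.toFinset.toList.length := (List.getElem?_eq_some_iff.1 hi).1
        rw [Finset.length_toList] at hlt
        exact ⟨⟨i, hlt.trans_le hm⟩, hi⟩
  · refine Finset.card_image_le.trans ?_
    simp [Nat.card_eq_fintype_card]

/-! ### A locally dense join -/

/-- Non-adjacent vertices `x`, `y` of `F` can be placed in `B`, and the other vertices in `A`. As `y`
may be mapped to any vertex of `B` but the image of `x`, the images of the edges that do not contain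
`y` lie in many copies of `F`. -/
lemma exists_map_joinIndependent {A B : Type*} [Finite A] [Fintype B] [Nontrivial B]
    {F : SimpleGraph U} {H : SimpleGraph A} {x y : U} (hxy : x ≠ y) (hF : ¬ F.Adj x y)
    (σ : {k // k ≠ x ∧ k ≠ y} ≃ A) (hσ : ∀ u v, F.Adj u.1 v.1 → H.Adj (σ u) (σ v)) (b : B) :
    ∃ g : U → A ⊕ B, g x = .inr b ∧ (∀ k hk, g k = .inl (σ ⟨k, hk⟩)) ∧
      ∀ i j, F.Adj i j → i ≠ y → j ≠ y → Fintype.card B - 1 ≤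
        {S : (joinIndependent H B).Subgraph |
          s(g i, g j) ∈ S.edgeSet ∧ Nonempty (F ≃g S.coe)}.ncard := by
  classical
  obtain ⟨b', hb'⟩ := exists_ne b
  obtain ⟨g, hgx, hgy, hgk⟩ : ∃ g : U → A ⊕ B, g x = .inr b ∧ g y = .inr b' ∧
      ∀ k hk, g k = .inl (σ ⟨k, hk⟩) := by
    refine ⟨fun k => if hk : k ≠ x ∧ k ≠ y then .inl (σ ⟨k, hk⟩) else
      if k = x then .inr b else .inr b', ?_, ?_, ?_⟩
    · simp
    · simp [hxy.symm]
    · intro k hk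
      exact dif_pos hk
  have hcases : ∀ k, k = x ∨ k = y ∨ (k ≠ x ∧ k ≠ y) := fun k => by tauto
  refine ⟨g, hgx, hgk, fun i j hij hi hj => ?_⟩
  have hinj : Function.Injective g := by
    intro u v huv
    rcases hcases u with rfl | rfl | hu <;> rcases hcases v with rfl | rfl | hv
    all_goals first
      | rfl
      | (rw [hgk _ hu, hgk _ hv] at huv
         exact congrArg Subtype.val (σ.injective (Sum.inl_injective huv)))
      | (simp only [hgx, hgy, hgk _ hu, reduceCtorEq] at huv)
      | (simp only [hgx, hgy, hgk _ hv, reduceCtorEq] at huv)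
      | (rw [hgx, hgy] at huv; exact absurd (Sum.inr_injective huv).symm hb')
      | (rw [hgx, hgy] at huv; exact absurd (Sum.inr_injective huv) hb')
  have h1 := card_le_ncard_copies_of_update (F := F) (G := joinIndependent H B) hinj y
    ((Finset.univ.erase b).map ⟨Sum.inr, Sum.inr_injective⟩)
    (by
      intro z hz u hu
      obtain ⟨c, hc, rfl⟩ := Finset.mem_map.1 hz
      rcases hcases u with rfl | rfl | hu'
      · rw [hgx]
        intro h
        exact (Finset.mem_erase.1 hc).1 (Sum.inr_injective h).symm
      · exact absurd rfl hu
      · rw [hgk u hu']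
        exact Sum.inl_ne_inr)
    (by
      intro u v huv hu hv
      rcases hcases u with rfl | rfl | hu' <;> rcases hcases v with rfl | rfl | hv'
      all_goals try contradiction
      · exact absurd rfl huv.ne
      · rw [hgx, hgk v hv']
        exact joinIndependent_adj_inl_inr.symm
      · rw [hgx, hgk u hu']
        exact joinIndependent_adj_inl_inr
      · rw [hgk u hu', hgk v hv']
        exact joinIndependent_adj_inl_inl.2 (hσ _ _ huv))
    (by
      intro z hz u hu
      obtain ⟨c, hc, rfl⟩ := Finset.mem_map.1 hz
      rcases hcases u with rfl | rfl | hu'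
      · exact absurd hu hF
      · exact absurd rfl hu.ne
      · rw [hgk u hu']
        exact joinIndependent_adj_inl_inr)
    ⟨i, j, hij, hi, hj, rfl, rfl⟩
  rwa [Finset.card_map, Finset.card_erase_of_mem (Finset.mem_univ b), Finset.card_univ] at h1

/-- A graph that is neither complete nor empty has two non-adjacent vertices that are not both
isolated. -/
lemma exists_not_adj_and_adj {F : SimpleGraph U} (htop : F ≠ ⊤) (hbot : F ≠ ⊥) :
    ∃ x y i, x ≠ y ∧ ¬ F.Adj x y ∧ F.Adj i x := by
  by_contra! h
  obtain ⟨u, v, huv⟩ := SimpleGraph.ne_bot_iff_exists_adj.1 hbot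
  refine htop (SimpleGraph.ext ?_)
  ext x y
  rw [SimpleGraph.top_adj]
  refine ⟨SimpleGraph.Adj.ne, fun hxy => ?_⟩
  by_contra hnot
  -- the vertex `x` is isolated, and hence so is every other vertex
  by_cases hux : u = x
  · exact h x y v hxy hnot (hux ▸ huv.symm)
  · exact h u x v hux (fun h' => h x y u hxy hnot h') huv.symm

/-- For a suitable graph on `A`, every edge of its join with a large independent set lies in many
copies of `F`. The graph on `A` is complete if some edge of `F` is disjoint from two non-adjacent
vertices of `F`, and empty otherwise. -/
lemma exists_locallyDense_joinIndependent {ℓ t : ℕ} (ht : 0 < t) {F : SimpleGraph (Fin ℓ)}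
    (htop : F ≠ ⊤) (hbot : F ≠ ⊥) :
    ∃ H : SimpleGraph (Fin (ℓ - 2)), LocallyDense F t (joinIndependent H (Fin (t + 1))) := by
  classical
  have hnt : Nontrivial (Fin (t + 1)) := Fin.nontrivial_iff_two_le.2 (by omega)
  have hequiv : ∀ x y : Fin ℓ, x ≠ y → Nonempty ({k // k ≠ x ∧ k ≠ y} ≃ Fin (ℓ - 2)) := by
    intro x y hxy
    refine ⟨Fintype.equivFinOfCardEq ?_⟩
    rw [Fintype.card_subtype, show (Finset.univ.filter fun k => k ≠ x ∧ k ≠ y) =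
      Finset.univ \ {x, y} by ext; simp, Finset.card_univ_sdiff, Fintype.card_fin,
      Finset.card_pair hxy]
  obtain ⟨x, y, i, hxy, hF, hix⟩ := exists_not_adj_and_adj htop hbot
  have hi : i ≠ x ∧ i ≠ y := ⟨hix.ne, fun h => hF (h ▸ hix.symm)⟩
  -- the edges between the two parts
  have hmixed : ∀ H : SimpleGraph (Fin (ℓ - 2)),
      (∀ σ : {k // k ≠ x ∧ k ≠ y} ≃ Fin (ℓ - 2), ∀ u v, F.Adj u.1 v.1 → H.Adj (σ u) (σ v)) →
      ∀ a b, t ≤ {S : (joinIndependent H (Fin (t + 1))).Subgraph |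
          s(.inl a, .inr b) ∈ S.edgeSet ∧ Nonempty (F ≃g S.coe)}.ncard := by
    intro H hH a b
    obtain ⟨σ₀⟩ := hequiv x y hxy
    let σ := σ₀.trans (Equiv.swap (σ₀ ⟨i, hi⟩) a)
    obtain ⟨g, hgx, hgk, hg⟩ := exists_map_joinIndependent hxy hF σ (hH σ) b
    have h1 := hg i x hix hi.2 hxy
    rw [hgk i hi, hgx] at h1
    simpa [σ] using h1
  by_cases hcase : ∃ x y : Fin ℓ, x ≠ y ∧ ¬ F.Adj x y ∧ ∃ i j, F.Adj i j ∧
      (i ≠ x ∧ i ≠ y) ∧ (j ≠ x ∧ j ≠ y)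
  · obtain ⟨x', y', hxy', hF', i', j', hij', hi', hj'⟩ := hcase
    refine ⟨⊤, ?_⟩
    have htopσ : ∀ x y : Fin ℓ, ∀ σ : {k // k ≠ x ∧ k ≠ y} ≃ Fin (ℓ - 2), ∀ u v,
        F.Adj u.1 v.1 → (⊤ : SimpleGraph (Fin (ℓ - 2))).Adj (σ u) (σ v) := by
      intro x y σ u v huv
      rw [SimpleGraph.top_adj, ne_eq, σ.injective.eq_iff]
      rintro rfl
      exact huv.ne rfl
    intro e he
    induction e with
    | h p q =>
      rcases p with a | b <;> rcases q with a' | b'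
      · have haa' : a ≠ a' := (joinIndependent_adj_inl_inl.1 he).ne
        obtain ⟨σ₀⟩ := hequiv x' y' hxy'
        have hne : (⟨i', hi'⟩ : {k // k ≠ x' ∧ k ≠ y'}) ≠ ⟨j', hj'⟩ :=
          fun h => hij'.ne (congrArg Subtype.val h)
        obtain ⟨σ, hσi, hσj⟩ := exists_equiv_map_pair σ₀ hne haa'
        obtain ⟨g, -, hgk, hg⟩ :=
          exists_map_joinIndependent hxy' hF' σ (htopσ x' y' σ) (0 : Fin (t + 1))
        have h1 := hg i' j' hij' hi'.2 hj'.2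
        rw [hgk i' hi', hgk j' hj', hσi, hσj] at h1
        simpa using h1
      · exact hmixed ⊤ (htopσ x y) a b'
      · rw [Sym2.eq_swap]
        exact hmixed ⊤ (htopσ x y) a' b
      · exact absurd he not_joinIndependent_adj_inr_inr
  · refine ⟨⊥, ?_⟩
    push Not at hcase
    have hbotσ : ∀ σ : {k // k ≠ x ∧ k ≠ y} ≃ Fin (ℓ - 2), ∀ u v,
        F.Adj u.1 v.1 → (⊥ : SimpleGraph (Fin (ℓ - 2))).Adj (σ u) (σ v) := by
      intro σ u v huv
      exact absurd (hcase x y hxy hF u.1 v.1 huv u.2 v.2.1) v.2.2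
    intro e he
    induction e with
    | h p q =>
      rcases p with a | b <;> rcases q with a' | b'
      · exact absurd (joinIndependent_adj_inl_inl.1 he) (by simp)
      · exact hmixed ⊥ hbotσ a b'
      · rw [Sym2.eq_swap]
        exact hmixed ⊥ hbotσ a' b
      · exact absurd he not_joinIndependent_adj_inr_inr

lemma exists_joinIndependent {ℓ t : ℕ} (hℓ : 3 ≤ ℓ) (ht : 0 < t) {F : SimpleGraph (Fin ℓ)}
    (htop : F ≠ ⊤) (hbot : F ≠ ⊥) :
    ∃ H : SimpleGraph (Fin (ℓ - 2)), joinIndependent H (Fin (t + 1)) ≠ ⊥ ∧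
      LocallyDense F t (joinIndependent H (Fin (t + 1))) ∧
      maxSubdivisions F (joinIndependent H (Fin (t + 1))) ≤
        2 ^ ℓ * (t + 2) ^ (F.edgeSet.ncard + 2 * ℓ) := by
  obtain ⟨H, hH⟩ := exists_locallyDense_joinIndependent ht htop hbot
  refine ⟨H, ?_, hH, (maxSubdivisions_joinIndependent_le F H).trans ?_⟩
  · exact SimpleGraph.ne_bot_iff_exists_adj.2
      ⟨.inl ⟨0, by omega⟩, .inr 0, joinIndependent_adj_inl_inr⟩
  · rw [Nat.card_fin, Nat.card_fin, Nat.card_fin]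
    refine Nat.mul_le_mul (Nat.pow_le_pow_right (by norm_num) (by omega)) ?_
    exact Nat.pow_le_pow_right (by omega) (by omega)

end LocalSubdivisions

theorem theorem2 (ℓ : ℕ) (hℓ : 3 ≤ ℓ) :
    ∃ c' : ℝ, 1 / (2 * ((ℓ : ℝ) - 2)) ≤ c' ∧
    ∃ o : ℕ → ℝ, Filter.Tendsto o Filter.atTop (nhds 0) ∧
    ∃ t₀ : ℕ, ∀ t : ℕ, t₀ ≤ t →
      -- (i)
      (2 : ℝ) ^ ((t : ℝ) ^ c') ≤
          (LocalSubdivisions.minSubdivisions (⊤ : SimpleGraph (Fin ℓ)) t : ℝ) ∧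
      -- (ii)
      (∀ F : SimpleGraph (Fin ℓ), F ≠ ⊤ → F ≠ ⊥ →
        LocalSubdivisions.minSubdivisions F t ≤ 2 ^ ℓ * (t + 2) ^ (F.edgeSet.ncard + 2 * ℓ) ∧
        ∃ H : SimpleGraph (Fin (ℓ - 2)),
          LocalSubdivisions.LocallyDense F t
              (LocalSubdivisions.joinIndependent H (Fin (t + 1))) ∧
            LocalSubdivisions.maxSubdivisions F
                (LocalSubdivisions.joinIndependent H (Fin (t + 1))) ≤
              2 ^ ℓ * (t + 2) ^ (F.edgeSet.ncard + 2 * ℓ)) ∧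
      -- (iii)
      (4 ≤ ℓ → ∀ e ∈ (⊤ : SimpleGraph (Fin ℓ)).edgeSet,
        ∀ K : SimpleGraph (Fin ℓ), K = (⊤ : SimpleGraph (Fin ℓ)).deleteEdges {e} →
          (t : ℝ) ^ ((1 - o t) * ((K.edgeSet.ncard : ℝ) - 2 * ℓ + 5)) ≤
            (LocalSubdivisions.minSubdivisions K t : ℝ)) := by
  obtain ⟨t₁, h₁⟩ := LocalSubdivisions.two_rpow_le_minSubdivisions_top hℓ
  obtain ⟨t₂, h₂⟩ : ∃ t₂ : ℕ, 4 ≤ ℓ → ∀ t : ℕ, t₂ ≤ t → ∀ x y : Fin ℓ, x ≠ y →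
      ∀ K : SimpleGraph (Fin ℓ), (∀ u v, K.Adj u v ↔ u ≠ v ∧ s(u, v) ≠ s(x, y)) →
        t ^ ((ℓ - 2).choose 2 + 1) ≤ LocalSubdivisions.minSubdivisions K t := by
    by_cases hℓ4 : 4 ≤ ℓ
    · obtain ⟨t₂, h₂⟩ := LocalSubdivisions.pow_le_minSubdivisions_deleteEdge hℓ4
      exact ⟨t₂, fun _ => h₂⟩
    · exact ⟨0, fun h => absurd h hℓ4⟩
  -- the bound for the complete graph minus an edge holds without any loss in the exponent
  refine ⟨_, le_rfl, fun _ => 0, tendsto_const_nhds, max (max t₁ t₂) 1, fun t ht => ⟨?_, ?_, ?_⟩⟩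
  · exact h₁ t (by omega)
  · intro F htop hbot
    obtain ⟨H, hne, hd, hmax⟩ :=
      LocalSubdivisions.exists_joinIndependent hℓ (show 0 < t by omega) htop hbot
    refine ⟨le_trans (Nat.sInf_le ?_) hmax, H, hd, hmax⟩
    exact ⟨Fin (ℓ - 2) ⊕ Fin (t + 1), inferInstance, _, hne, hd, rfl⟩
  · intro hℓ4 e he K hK
    induction e with
    | h x y =>
      have h3 := h₂ hℓ4 t (by omega) x y (SimpleGraph.ne_of_adj ⊤ he) K (by
        intro u v
        rw [hK, SimpleGraph.deleteEdges_adj, SimpleGraph.top_adj, Set.mem_singleton_iff])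
      rw [hK, LocalSubdivisions.ncard_edgeSet_deleteEdge hℓ4 he, sub_zero, one_mul,
        Real.rpow_natCast, ← hK]
      exact_mod_cast h3
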